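/- Let INF be intuitionistic NF: the theory in first-order intuitionistic logic with equality whose only other primitive is $\in$, and whose axioms are extensionality (sets with the same elements are equal) and stratified comprehension ($\{y:\varphi(y)\}$ exists for every stratified formula $\varphi$, possibly with parameters). A formula is stratified if its variables can be given natural-number indices so that $y$ gets an index one greater than $x$ in each subformula $x\in y$, and $x,y$ get the same index in each subformula $x=y$. In INF, let $\Lambda$ be the empty set, ${\sf zero}=\{\Lambda\}$, and for arbitrary sets put $$\kappa^+=\{x:\exists z,a\,(z\in\kappa\wedge a\notin z\wedge x=z\cup\{a\})\},$$ $$x+y=\{z:\exists u,v\,(u\in x\wedge v\in y\wedge u\cap v=\Lambda\wedge z=u\cup v)\}.$$ Let $\mathbb F$ (the finite cardinals) be the intersection of all $w$ such that ${\sf zero}\in w$ and $\mu^+\in w$ whenever $\mu\in w$ and $\mu^+$ has a member; let $SF$ (the semifinite cardinals) be the intersection of all $w$ that contain ${\sf zero}$ and are closed under $\kappa\mapsto\kappa^+$. With $\langle x,y\rangle=\{\{x\},\{x,y\}\}$ and $\langle x,y,z\rangle=\langle\langle x,y\rangle,\{\{z\}\}\rangle$, let $\mathbb G$ be the intersection of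 all $w$ such that $$x\in SF\to\langle x,{\sf zero},{\sf zero}\rangle\in w,\qquad x\in SF\to\langle{\sf zero},x,{\sf zero}\rangle\in w,\qquad \langle x,y,z\rangle\in w\to\langle x,y^+,z+x\rangle\in w,$$ and let $x\cdot y=\{u:\exists z\,(\langle x,y,z\rangle\in\mathbb G\wedge u\in z)\}$. Theorem. INF proves that the sets ${\sf zero}$, $\mathbb F$, $SF$ and $\mathbb G$ exist, that $\mathbb G$ itself satisfies the three conditions above (so it is the least set satisfying them), and that the following hold, where the existence of the sets denoted by the products is part of the assertion: 1. If $x,y\in\mathbb F$, then $x\cdot y\in SF$, and for all $z$, $\langle x,y,z\rangle\in\mathbb G\leftrightarrow z=x\cdot y$. 2. If $x,y\in\mathbb F$ and $y^+\in\mathbb F$, then $x\cdot y^+=x\cdot y+x$. (It is not assumed that $x\cdot y^+\in\mathbb F$; if $x\cdot y^+\notin\mathbb F$, then both sides are $\Lambda$.) 3. If $x,y,z\in\mathbb F$ and $y+z\in\mathbb F$, then $x\cdot(y+z)=x\cdot y+x\cdot z$. 4. If $x,y,z\in\mathbb F$ and $x+y\in\mathbb F$, then $(x+y)\cdot z=x\cdot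 z+y\cdot z$. 5. If $x,y\in\mathbb F$, then $x\cdot y=y\cdot x$. 6. If $x,y,z\in\mathbb F$, $x\cdot y\in\mathbb F$ and $y\cdot z\in\mathbb F$, then $x\cdot(y\cdot z)=(x\cdot y)\cdot z$. -/

import Mathlib

namespace INF

/-! ### The language of set theory

Formulas are built from `∈` and `=` by the connectives and quantifiers, all of them primitive because
the logic is intuitionistic.  Variables are de Bruijn indices: below a quantifier, index `0` is the
variable bound by it, and the index `n + 1` is the variable with index `n` outside. -/

inductive Fm : Type
  | mem (i j : ℕ) : Fm
  | eq (i j : ℕ) : Fm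
  | fls : Fm
  | and (a b : Fm) : Fm
  | or (a b : Fm) : Fm
  | imp (a b : Fm) : Fm
  | all (a : Fm) : Fm
  | ex (a : Fm) : Fm

infix:50 " ∊ " => Fm.mem
infix:50 " ≗ " => Fm.eq
infixr:35 " ⩓ " => Fm.and
infixr:30 " ⩔ " => Fm.or
infixr:25 " ⇾ " => Fm.imp

namespace Fm

def neg (a : Fm) : Fm := a ⇾ fls

def iff (a b : Fm) : Fm := (a ⇾ b) ⩓ (b ⇾ a)

end Fm

infix:20 " ⇿ " => Fm.iff

/-- The sequence `k, f 0, f 1, f 2, …`. -/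
def cons (k : ℕ) (f : ℕ → ℕ) : ℕ → ℕ
  | 0 => k
  | n + 1 => f n

/-- A renaming of the variables, extended to the inside of a quantifier. -/
def up (ρ : ℕ → ℕ) : ℕ → ℕ := cons 0 (fun n => ρ n + 1)

namespace Fm

/-- Simultaneous capture-free replacement of each free variable `n` by the variable `ρ n`. -/
def rename : Fm → (ℕ → ℕ) → Fm
  | mem i j, ρ => mem (ρ i) (ρ j)
  | eq i j, ρ => eq (ρ i) (ρ j)
  | fls, _ => fls
  | and a b, ρ => and (a.rename ρ) (b.rename ρ)
  | or a b, ρ => or (a.rename ρ) (b.rename ρ)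
  | imp a b, ρ => imp (a.rename ρ) (b.rename ρ)
  | all a, ρ => all (a.rename (up ρ))
  | ex a, ρ => ex (a.rename (up ρ))

/-- The same formula, read below one more quantifier that does not bind anything in it. -/
def shift (a : Fm) : Fm := a.rename Nat.succ

/-- The body `a` of a quantifier with the bound variable replaced by the variable `k`. -/
def inst (a : Fm) (k : ℕ) : Fm := a.rename (cons k id)

/-- `a.Typed τ`: the free variable `n` having index `τ n`, the bound variables of `a` can be given
indices that stratify `a`. -/
def Typed : Fm → (ℕ → ℕ) → Prop
  | mem i j, τ => τ j = τ i + 1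
  | eq i j, τ => τ i = τ j
  | fls, _ => True
  | and a b, τ => a.Typed τ ∧ b.Typed τ
  | or a b, τ => a.Typed τ ∧ b.Typed τ
  | imp a b, τ => a.Typed τ ∧ b.Typed τ
  | all a, τ => ∃ k, a.Typed (cons k τ)
  | ex a, τ => ∃ k, a.Typed (cons k τ)

def Stratified (a : Fm) : Prop := ∃ τ, a.Typed τ

end Fm

open Fm

/-! ### The theory INF -/

/-- Two sets with the same elements are equal. -/
def extensionality : Fm :=
  all (all (all (0 ∊ 2 ⇿ 0 ∊ 1) ⇾ 1 ≗ 0))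

/-- The set `{y : a}` exists.  In `a`, the variable `0` is `y`, and all others are parameters; the
renaming keeps `y` and makes the new set not occur in `a`. -/
def comprehension (a : Fm) : Fm :=
  ex (all (0 ∊ 1 ⇿ a.rename (up Nat.succ)))

/-- The non-logical axioms of INF.  The free variables (parameters) of an instance of comprehension
are understood universally. -/
inductive Postulate : Fm → Prop
  | ext : Postulate extensionality
  | compr (a : Fm) (h : a.Stratified) : Postulate (comprehension a)

/-- `Proves Γ a`: the formula `a` is derivable in INF from the assumptions `Γ`, in intuitionistic
natural deduction with equality.  (No rule of excluded middle or double negation.) -/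
inductive Proves : List Fm → Fm → Prop
  | postulate {Γ : List Fm} {a : Fm} : Postulate a → Proves Γ a
  | hyp {Γ : List Fm} {a : Fm} : a ∈ Γ → Proves Γ a
  | flsE {Γ : List Fm} {a : Fm} : Proves Γ fls → Proves Γ a
  | andI {Γ : List Fm} {a b : Fm} : Proves Γ a → Proves Γ b → Proves Γ (a ⩓ b)
  | andE₁ {Γ : List Fm} {a b : Fm} : Proves Γ (a ⩓ b) → Proves Γ a
  | andE₂ {Γ : List Fm} {a b : Fm} : Proves Γ (a ⩓ b) → Proves Γ b
  | orI₁ {Γ : List Fm} {a b : Fm} : Proves Γ a → Proves Γ (a ⩔ b)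
  | orI₂ {Γ : List Fm} {a b : Fm} : Proves Γ b → Proves Γ (a ⩔ b)
  | orE {Γ : List Fm} {a b c : Fm} :
      Proves Γ (a ⩔ b) → Proves (a :: Γ) c → Proves (b :: Γ) c → Proves Γ c
  | impI {Γ : List Fm} {a b : Fm} : Proves (a :: Γ) b → Proves Γ (a ⇾ b)
  | impE {Γ : List Fm} {a b : Fm} : Proves Γ (a ⇾ b) → Proves Γ a → Proves Γ b
  | allI {Γ : List Fm} {a : Fm} : Proves (Γ.map shift) a → Proves Γ (all a)
  | allE {Γ : List Fm} {a : Fm} (k : ℕ) : Proves Γ (all a) → Proves Γ (a.inst k)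
  | exI {Γ : List Fm} {a : Fm} (k : ℕ) : Proves Γ (a.inst k) → Proves Γ (ex a)
  | exE {Γ : List Fm} {a c : Fm} :
      Proves Γ (ex a) → Proves (a :: Γ.map shift) c.shift → Proves Γ c
  | eqI {Γ : List Fm} (i : ℕ) : Proves Γ (i ≗ i)
  | eqE {Γ : List Fm} {i j : ℕ} (a : Fm) : Proves Γ (i ≗ j) → Proves Γ (a.inst i) → Proves Γ (a.inst j)

/-! ### The notions of the theory, as formulas

The arguments are variables.  A defined term `t` is rendered by the formula "`v` is `t`". -/

/-- `e = Λ`, the empty set -/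
def isEmpty (e : ℕ) : Fm := all (neg (0 ∊ e + 1))

/-- `∃ u, u ∈ k` -/
def inhabited (k : ℕ) : Fm := ex (0 ∊ k + 1)

/-- `u ∩ v = Λ` -/
def disjoint (u v : ℕ) : Fm := all (neg (0 ∊ u + 1 ⩓ 0 ∊ v + 1))

/-- `w = u ∪ v` -/
def isUnion (w u v : ℕ) : Fm := all (0 ∊ w + 1 ⇿ 0 ∊ u + 1 ⩔ 0 ∊ v + 1)

/-- `w = z ∪ {a}` -/
def isAdjoin (w z a : ℕ) : Fm := all (0 ∊ w + 1 ⇿ 0 ∊ z + 1 ⩔ 0 ≗ a + 1)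

/-- `s = {a}` -/
def isSingleton (s a : ℕ) : Fm := all (0 ∊ s + 1 ⇿ 0 ≗ a + 1)

/-- `p = {a, b}` -/
def isUnordered (p a b : ℕ) : Fm := all (0 ∊ p + 1 ⇿ 0 ≗ a + 1 ⩔ 0 ≗ b + 1)

/-- `p = ⟨a, b⟩ = {{a}, {a, b}}` -/
def isPair (p a b : ℕ) : Fm :=
  all (0 ∊ p + 1 ⇿ isSingleton 0 (a + 1) ⩔ isUnordered 0 (a + 1) (b + 1))

/-- `t = ⟨x, y, z⟩ = ⟨⟨x, y⟩, {{z}}⟩`.  The bound variables are `q = ⟨x, y⟩` (`2`), `{z}` (`1`)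
and `{{z}}` (`0`). -/
def isTriple (t x y z : ℕ) : Fm :=
  ex (ex (ex (isPair 2 (x + 3) (y + 3) ⩓ isSingleton 1 (z + 3) ⩓ isSingleton 0 1 ⩓
    isPair (t + 3) 2 0)))

/-- `⟨x, y, z⟩ ∈ w` -/
def tripleMem (x y z w : ℕ) : Fm :=
  ex (isTriple 0 (x + 1) (y + 1) (z + 1) ⩓ 0 ∊ w + 1)

/-- `o = zero = {Λ}` -/
def isZero (o : ℕ) : Fm := all (0 ∊ o + 1 ⇿ isEmpty 0)

/-- `s = k⁺ = {x : ∃ z a, z ∈ k ∧ a ∉ z ∧ x = z ∪ {a}}`; here `x, z, a` are `2, 1, 0`. -/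
def isSucc (s k : ℕ) : Fm :=
  all (0 ∊ s + 1 ⇿ ex (ex (1 ∊ k + 3 ⩓ neg (0 ∊ 1) ⩓ isAdjoin 2 1 0)))

/-- `r = x + y = {z : ∃ u v, u ∈ x ∧ v ∈ y ∧ u ∩ v = Λ ∧ z = u ∪ v}`; here `z, u, v` are `2, 1, 0`. -/
def isSum (r x y : ℕ) : Fm :=
  all (0 ∊ r + 1 ⇿ ex (ex (1 ∊ x + 3 ⩓ 0 ∊ y + 3 ⩓ disjoint 1 0 ⩓ isUnion 2 1 0)))

/-- `F` is the set `𝔽` of finite cardinals, `o` being zero: `κ ∈ F` iff `κ` belongs to every `w` that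
contains zero and contains `μ⁺` whenever `μ ∈ w` and `μ⁺` is inhabited. -/
def isFinCard (F o : ℕ) : Fm :=
  all (0 ∊ F + 1 ⇿
    all (o + 2 ∊ 0 ⩓ all (all (1 ∊ 2 ⩓ isSucc 0 1 ⩓ inhabited 0 ⇾ 0 ∊ 2)) ⇾ 1 ∊ 0))

/-- `S` is the set `SF` of semifinite cardinals, `o` being zero: `κ ∈ S` iff `κ` belongs to every `w`
that contains zero and is closed under successor. -/
def isSemifin (S o : ℕ) : Fm :=
  all (0 ∊ S + 1 ⇿
    all (o + 2 ∊ 0 ⩓ all (all (1 ∊ 2 ⩓ isSucc 0 1 ⇾ 0 ∊ 2)) ⇾ 1 ∊ 0))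

/-- The closure conditions on `w` in the definition of multiplication, `o` being zero and `S` being
`SF`: `⟨x, 0, 0⟩ ∈ w` and `⟨0, x, 0⟩ ∈ w` for all `x ∈ S`, and `⟨x, y, z⟩ ∈ w` implies
`⟨x, y⁺, z + x⟩ ∈ w`.  In the last clause `x, y, z, y⁺, z + x` are `4, 3, 2, 1, 0`. -/
def mulClosed (w S o : ℕ) : Fm :=
  all (0 ∊ S + 1 ⇾ tripleMem 0 (o + 1) (o + 1) (w + 1)) ⩓
  all (0 ∊ S + 1 ⇾ tripleMem (o + 1) 0 (o + 1) (w + 1)) ⩓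
  all (all (all (all (all (tripleMem 4 3 2 (w + 5) ⩓ isSucc 1 3 ⩓ isSum 0 2 4 ⇾
    tripleMem 4 1 0 (w + 5))))))

/-- `G` is the graph `𝔾` of multiplication: the intersection of all `w` satisfying the conditions. -/
def isMulGraph (G S o : ℕ) : Fm :=
  all (0 ∊ G + 1 ⇿ all (mulClosed 0 (S + 2) (o + 2) ⇾ 1 ∊ 0))

/-- `p = x · y = {u : ∃ z, ⟨x, y, z⟩ ∈ G ∧ u ∈ z}` -/
def isProd (p x y G : ℕ) : Fm :=
  all (0 ∊ p + 1 ⇿ ex (tripleMem (x + 2) (y + 2) 0 (G + 2) ⩓ 1 ∊ 0))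

/-! ### The assertions about multiplication

`F`, `S` and `G` are the variables for `𝔽`, `SF` and `𝔾`. -/

/-- For `x, y ∈ F`, the product `p = x · y` exists and belongs to `SF`, and for all `z`,
`⟨x, y, z⟩ ∈ G` iff `z = p`. -/
def mulDefined (F S G : ℕ) : Fm :=
  all (all (1 ∊ F + 2 ⩓ 0 ∊ F + 2 ⇾
    ex (isProd 0 2 1 (G + 3) ⩓ 0 ∊ S + 3 ⩓ all (tripleMem 3 2 0 (G + 4) ⇿ 0 ≗ 1))))

/-- For `x, y ∈ F` with `s = y⁺ ∈ F`, there are `p = x · y⁺` and `q = x · y`, and `p = q + x`;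
moreover `p = Λ` if `p ∉ F`.  Here `x, y, s, p, q` are `4, 3, 2, 1, 0` in the conclusion. -/
def mulSucc (F G : ℕ) : Fm :=
  all (all (all (2 ∊ F + 3 ⩓ 1 ∊ F + 3 ⩓ isSucc 0 1 ⩓ 0 ∊ F + 3 ⇾
    ex (ex (isProd 1 4 2 (G + 5) ⩓ isProd 0 4 3 (G + 5) ⩓ isSum 1 0 4 ⩓
      (neg (1 ∊ F + 5) ⇾ isEmpty 1))))))

/-- For `x, y, z ∈ F` with `s = y + z ∈ F`, there are `p = x · s`, `q = x · y` and `r = x · z`, and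
`p = q + r`.  Here `x, y, z, s, p, q, r` are `6, 5, 4, 3, 2, 1, 0` in the conclusion. -/
def rightDistrib (F G : ℕ) : Fm :=
  all (all (all (all
    (3 ∊ F + 4 ⩓ 2 ∊ F + 4 ⩓ 1 ∊ F + 4 ⩓ isSum 0 2 1 ⩓ 0 ∊ F + 4 ⇾
      ex (ex (ex (isProd 2 6 3 (G + 7) ⩓ isProd 1 6 5 (G + 7) ⩓ isProd 0 6 4 (G + 7) ⩓
        isSum 2 1 0)))))))

/-- For `x, y, z ∈ F` with `s = x + y ∈ F`, there are `p = s · z`, `q = x · z` and `r = y · z`, and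
`p = q + r`.  Here `x, y, z, s, p, q, r` are `6, 5, 4, 3, 2, 1, 0` in the conclusion. -/
def leftDistrib (F G : ℕ) : Fm :=
  all (all (all (all
    (3 ∊ F + 4 ⩓ 2 ∊ F + 4 ⩓ 1 ∊ F + 4 ⩓ isSum 0 3 2 ⩓ 0 ∊ F + 4 ⇾
      ex (ex (ex (isProd 2 3 4 (G + 7) ⩓ isProd 1 6 4 (G + 7) ⩓ isProd 0 5 4 (G + 7) ⩓
        isSum 2 1 0)))))))

/-- For `x, y ∈ F` there is `p` with `p = x · y` and `p = y · x`. -/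
def mulComm (F G : ℕ) : Fm :=
  all (all (1 ∊ F + 2 ⩓ 0 ∊ F + 2 ⇾
    ex (isProd 0 2 1 (G + 3) ⩓ isProd 0 1 2 (G + 3))))

/-- For `x, y, z ∈ F` with `a = x · y ∈ F` and `b = y · z ∈ F`, there is `p` with `p = x · b` and
`p = a · z`.  Here `x, y, z, a, b, p` are `5, 4, 3, 2, 1, 0` in the conclusion. -/
def mulAssoc (F G : ℕ) : Fm :=
  all (all (all (all (all
    (4 ∊ F + 5 ⩓ 3 ∊ F + 5 ⩓ 2 ∊ F + 5 ⩓
      isProd 1 4 3 (G + 5) ⩓ 1 ∊ F + 5 ⩓ isProd 0 3 2 (G + 5) ⩓ 0 ∊ F + 5 ⇾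
      ex (isProd 0 5 1 (G + 6) ⩓ isProd 0 2 3 (G + 6)))))))

end INF

namespace INF

open Fm

/-! ### Renaming -/

/-! The calculus is first made usable. A rule that binds a variable is proved in a form that speaks
of an arbitrary variable `k` (`all_intro`, `ex_elim`): for a fresh `k`, an injective renaming moves
it to index 0. `rename_of_forall` then allows comprehension with arbitrary, possibly equal,
parameters. After that each step inside INF is an ordinary step about assertions `Γ ⊩ a`.

The mathematical difficulty is that successors, sums and products of finite cardinals may be empty,
and that membership is not decidable. Addition causes no trouble: commutativity, associativity and x
+ y⁺ = (x + y)⁺ hold for arbitrary sets. For the successor, `mem_of_adjoin_mem_succ` shows that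
removing any element from a member of k⁺ leaves a member of k. The only case distinctions needed
come from membership in an adjunction. Hence semifinite cardinals with a common member are equal
(`eq_of_common_mem`), and successor is injective where it is inhabited (`succ_inj`).

Minimality of 𝔾 gives an inversion principle (`mulCases_of_tripleMem`): every triple in 𝔾 comes from
one of the three closure conditions. Induction on y ∈ 𝔽 then gives exactly one z with ⟨x, y, z⟩ ∈ 𝔾
(`Arith.exists_mulValue`). At y⁺ the predecessor is unique because y⁺ is inhabited. The value is
only known to be semifinite, because it may be empty.

The recursion x · y⁺ = x · y + x now yields both distributive laws by induction, then commutativity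
(using 1 · x = x), then associativity. All induction formulas are stratified: cardinals get index 2,
𝔽 and SF index 3, triples of cardinals index 6, 𝔾 index 7. -/

theorem up_comp (σ ρ : ℕ → ℕ) : up σ ∘ up ρ = up (σ ∘ ρ) := by
  funext n; cases n <;> rfl

theorem up_id : up id = id := by
  funext n; cases n <;> rfl

theorem up_injective {ρ : ℕ → ℕ} (h : ρ.Injective) : (up ρ).Injective := by
  intro m n e
  cases m <;> cases n <;> simp [up, cons] at e ⊢
  exact h e

namespace Fm

theorem rename_rename (a : Fm) (ρ σ : ℕ → ℕ) : (a.rename ρ).rename σ = a.rename (σ ∘ ρ) := by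
  induction a generalizing ρ σ <;> simp_all [rename, up_comp]

theorem rename_id (a : Fm) : a.rename id = a := by
  induction a <;> simp_all [rename, up_id]

theorem inst_rename (a : Fm) (ρ : ℕ → ℕ) (k : ℕ) :
    (a.rename (up ρ)).inst k = a.rename (cons k ρ) := by
  rw [inst, rename_rename]
  congr 1
  funext n; cases n <;> rfl

theorem rename_inst (a : Fm) (ρ : ℕ → ℕ) (k : ℕ) :
    (a.inst k).rename ρ = (a.rename (up ρ)).inst (ρ k) := by
  rw [inst_rename, inst, rename_rename]
  congr 1
  funext n; cases n <;> rfl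

theorem shift_rename (a : Fm) (ρ : ℕ → ℕ) : a.shift.rename (up ρ) = (a.rename ρ).shift := by
  rw [shift, shift, rename_rename, rename_rename]
  rfl

/-- A bound for the indices occurring in a formula. -/
def bound : Fm → ℕ
  | mem i j => max i j + 1
  | eq i j => max i j + 1
  | fls => 0
  | and a b => max a.bound b.bound
  | or a b => max a.bound b.bound
  | imp a b => max a.bound b.bound
  | all a => a.bound
  | ex a => a.bound

theorem up_congr {ρ σ : ℕ → ℕ} {m : ℕ} (h : ∀ n < m, ρ n = σ n) : ∀ n < m, up ρ n = up σ n := by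
  intro n hn
  cases n with
  | zero => rfl
  | succ n => exact congrArg (· + 1) (h n (by omega))

theorem rename_congr {a : Fm} {ρ σ : ℕ → ℕ} (h : ∀ n < a.bound, ρ n = σ n) :
    a.rename ρ = a.rename σ := by
  induction a generalizing ρ σ with
  | mem i j => simp only [rename, bound] at *; rw [h i (by omega), h j (by omega)]
  | eq i j => simp only [rename, bound] at *; rw [h i (by omega), h j (by omega)]
  | fls => rfl
  | and a b iha ihb | or a b iha ihb | imp a b iha ihb =>
    simp only [rename, bound] at *
    rw [iha fun n hn => h n (by omega), ihb fun n hn => h n (by omega)]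
  | all a ih | ex a ih => simp only [rename, bound] at *; rw [ih (up_congr h)]

theorem typed_rename (a : Fm) (ρ τ : ℕ → ℕ) : (a.rename ρ).Typed τ ↔ a.Typed (τ ∘ ρ) := by
  have key : ∀ (k : ℕ) (ρ τ : ℕ → ℕ), cons k τ ∘ up ρ = cons k (τ ∘ ρ) := by
    intro k ρ τ; funext n; cases n <;> rfl
  induction a generalizing ρ τ <;> simp_all [rename, Typed]

/-- Injectivity lets the indices be carried along ρ; identifying two variables with different
indices could destroy stratification. -/
theorem Stratified.rename {a : Fm} (h : a.Stratified) {ρ : ℕ → ℕ} (hρ : ρ.Injective) :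
    (a.rename ρ).Stratified := by
  obtain ⟨τ, hτ⟩ := h
  refine ⟨Function.extend ρ τ 0, ?_⟩
  rw [typed_rename]
  convert hτ
  exact funext fun n => hρ.extend_apply τ 0 n

end Fm

/-- The renaming that makes room for a new variable `0` and moves `k` there. -/
def toZero (k n : ℕ) : ℕ := if n = k then 0 else n + 1

theorem toZero_injective (k : ℕ) : (toZero k).Injective := by
  intro m n
  unfold toZero
  split <;> split <;> omega

theorem rename_toZero {a : Fm} {k : ℕ} (h : a.bound ≤ k) : a.rename (toZero k) = a.shift :=
  rename_congr fun n hn => if_neg (by omega)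

/-- For `k` beyond every index in `a`, the instance at `k` loses no information: moving `k` back to
0 recovers the body of the quantifier. -/
theorem inst_toZero {a : Fm} {k : ℕ} (h : a.bound ≤ k) : (a.inst k).rename (toZero k) = a := by
  rw [inst, rename_rename]
  conv_rhs => rw [← a.rename_id]
  refine rename_congr fun n hn => ?_
  cases n with
  | zero => exact if_pos rfl
  | succ n => exact if_neg (show n ≠ k by omega)

theorem exists_fresh (Γ : List Fm) : ∃ k, ∀ a ∈ Γ, a.bound ≤ k := by
  induction Γ with
  | nil => exact ⟨0, by simp⟩
  | cons b Γ ih =>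
    obtain ⟨k, hk⟩ := ih
    refine ⟨max k b.bound, fun a ha => ?_⟩
    rcases List.mem_cons.1 ha with rfl | ha
    · omega
    · have := hk a ha; omega

theorem map_toZero {Γ : List Fm} {k : ℕ} (h : ∀ a ∈ Γ, a.bound ≤ k) :
    Γ.map (·.rename (toZero k)) = Γ.map shift :=
  List.map_congr_left fun a ha => rename_toZero (h a ha)

theorem map_shift_rename (Γ : List Fm) (ρ : ℕ → ℕ) :
    (Γ.map shift).map (·.rename (up ρ)) = (Γ.map (·.rename ρ)).map shift := by
  simp [shift_rename]

-- Structural rules: weakening, renaming, generalization from a fresh variable.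

infix:15 " ⊩ " => Proves

namespace Proves

theorem weaken {Γ Δ : List Fm} {a : Fm} (h : Γ ⊩ a) (s : Γ ⊆ Δ) : Δ ⊩ a := by
  induction h generalizing Δ with
  | postulate h => exact postulate h
  | hyp h => exact hyp (s h)
  | flsE _ ih => exact flsE (ih s)
  | andI _ _ ih₁ ih₂ => exact andI (ih₁ s) (ih₂ s)
  | andE₁ _ ih => exact andE₁ (ih s)
  | andE₂ _ ih => exact andE₂ (ih s)
  | orI₁ _ ih => exact orI₁ (ih s)
  | orI₂ _ ih => exact orI₂ (ih s)
  | orE _ _ _ ih ih₁ ih₂ =>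
    exact orE (ih s) (ih₁ (List.cons_subset_cons _ s)) (ih₂ (List.cons_subset_cons _ s))
  | impI _ ih => exact impI (ih (List.cons_subset_cons _ s))
  | impE _ _ ih₁ ih₂ => exact impE (ih₁ s) (ih₂ s)
  | allI _ ih => exact allI (ih (List.map_subset _ s))
  | allE k _ ih => exact allE k (ih s)
  | exI k _ ih => exact exI k (ih s)
  | exE _ _ ih₁ ih₂ => exact exE (ih₁ s) (ih₂ (List.cons_subset_cons _ (List.map_subset _ s)))
  | eqI i => exact eqI i
  | eqE a _ _ ih₁ ih₂ => exact eqE a (ih₁ s) (ih₂ s)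

/-- Injectivity is needed for the comprehension axioms only, whose renamed formula must again be
stratified. -/
theorem rename {Γ : List Fm} {a : Fm} (h : Γ ⊩ a) {ρ : ℕ → ℕ} (hρ : ρ.Injective) :
    Γ.map (·.rename ρ) ⊩ a.rename ρ := by
  induction h generalizing ρ with
  | postulate h =>
    cases h with
    | ext => exact postulate Postulate.ext
    | compr a h =>
      have e : (comprehension a).rename ρ = comprehension (a.rename (up ρ)) := by
        have : up (up ρ) ∘ up Nat.succ = up Nat.succ ∘ up ρ := by
          funext n; rcases n with _ | n <;> rfl
        simp only [comprehension, Fm.rename, Fm.iff, rename_rename, this]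
        rfl
      rw [e]
      exact postulate (Postulate.compr _ (h.rename (up_injective hρ)))
  | hyp h => exact hyp (List.mem_map_of_mem h)
  | flsE _ ih => exact flsE (ih hρ)
  | andI _ _ ih₁ ih₂ => exact andI (ih₁ hρ) (ih₂ hρ)
  | andE₁ _ ih => exact andE₁ (ih hρ)
  | andE₂ _ ih => exact andE₂ (ih hρ)
  | orI₁ _ ih => exact orI₁ (ih hρ)
  | orI₂ _ ih => exact orI₂ (ih hρ)
  | orE _ _ _ ih ih₁ ih₂ => exact orE (ih hρ) (ih₁ hρ) (ih₂ hρ)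
  | impI _ ih => exact impI (ih hρ)
  | impE _ _ ih₁ ih₂ => exact impE (ih₁ hρ) (ih₂ hρ)
  | allI _ ih =>
    refine allI ?_
    rw [← map_shift_rename]
    exact ih (up_injective hρ)
  | allE k _ ih => rw [rename_inst]; exact allE _ (ih hρ)
  | exI k _ ih => exact exI (ρ k) (by rw [← rename_inst]; exact ih hρ)
  | exE _ _ ih₁ ih₂ =>
    refine exE (ih₁ hρ) ?_
    rw [← map_shift_rename, ← shift_rename]
    exact ih₂ (up_injective hρ)
  | eqI i => exact eqI _
  | eqE a _ _ ih₁ ih₂ =>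
    rw [rename_inst]
    refine eqE _ (ih₁ hρ) ?_
    rw [← rename_inst]
    exact ih₂ hρ

/-- Only one fresh `k` is used: renaming by `toZero k` turns its derivation into the premise of
`allI`. Asking for all `k` spares users the choice. -/
theorem all_intro {Γ : List Fm} {a : Fm} (h : ∀ k, Γ ⊩ a.inst k) : Γ ⊩ all a := by
  obtain ⟨k, hk⟩ := exists_fresh (a :: Γ)
  have := (h k).rename (toZero_injective k)
  rw [inst_toZero (hk a (by simp)), map_toZero fun b hb => hk b (by simp [hb])] at this
  exact allI this

end Proves

/-! ### Extensions of the list of assumptions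

Derivations are carried out at the level of assertions `Γ ⊩ a`.  A rule that adds an assumption
passes to an extension `Δ` of `Γ`, and what holds in `Γ` is used in `Δ` through a coercion. -/

class Le (Γ Δ : List Fm) : Prop where
  sub : Γ ⊆ Δ

/-- The smaller list is an output parameter, so instance search starts from the current list and
walks back one extension at a time to the list where a fact was derived. -/
class Step (Γ : outParam (List Fm)) (Δ : List Fm) : Prop where
  sub : Γ ⊆ Δ

instance Le.trans_step {Γ Δ Θ : List Fm} [s : Step Δ Θ] [h : Le Γ Δ] : Le Γ Θ :=
  ⟨fun _ ha => s.sub (h.sub ha)⟩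

instance Le.refl (Γ : List Fm) : Le Γ Γ := ⟨fun _ ha => ha⟩

namespace Proves

theorem lift {Γ Δ : List Fm} [s : Le Γ Δ] {a : Fm} (h : Γ ⊩ a) : Δ ⊩ a := h.weaken s.sub

instance {Γ Δ : List Fm} [Le Γ Δ] {a : Fm} {h : Γ ⊩ a} : CoeT (Γ ⊩ a) h (Δ ⊩ a) := ⟨lift h⟩

variable {Γ : List Fm} {a b c : Fm}

theorem imp_intro (h : ∀ Δ [Step Γ Δ], (Δ ⊩ a) → (Δ ⊩ b)) : Γ ⊩ a ⇾ b :=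
  have : Step Γ (a :: Γ) := ⟨List.subset_cons_self _ _⟩
  impI (h (a :: Γ) (hyp (by simp)))

theorem or_elim (h : Γ ⊩ a ⩔ b) (ha : ∀ Δ [Step Γ Δ], (Δ ⊩ a) → (Δ ⊩ c))
    (hb : ∀ Δ [Step Γ Δ], (Δ ⊩ b) → (Δ ⊩ c)) : Γ ⊩ c :=
  orE h ((imp_intro ha).weaken (List.subset_cons_self _ _) |>.impE (hyp (by simp)))
    ((imp_intro hb).weaken (List.subset_cons_self _ _) |>.impE (hyp (by simp)))

/-- As for `all_intro`, a fresh witness is moved to index 0, which gives the premise of `exE`. -/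
theorem ex_elim (h : Γ ⊩ ex a) (hc : ∀ k Δ [Step Γ Δ], (Δ ⊩ a.inst k) → (Δ ⊩ c)) : Γ ⊩ c := by
  obtain ⟨k, hk⟩ := exists_fresh (c :: a :: Γ)
  have : Step Γ (a.inst k :: Γ) := ⟨List.subset_cons_self _ _⟩
  have := (hc k (a.inst k :: Γ) (hyp (by simp))).rename (toZero_injective k)
  rw [List.map_cons, inst_toZero (hk a (by simp)), map_toZero fun b hb => hk b (by simp [hb]),
    rename_toZero (hk c (by simp))] at this
  exact exE h this

theorem neg_elim (h : Γ ⊩ neg a) (ha : Γ ⊩ a) : Γ ⊩ c := flsE (impE h ha)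

theorem iff_intro (h₁ : ∀ Δ [Step Γ Δ], (Δ ⊩ a) → (Δ ⊩ b))
    (h₂ : ∀ Δ [Step Γ Δ], (Δ ⊩ b) → (Δ ⊩ a)) : Γ ⊩ a ⇿ b :=
  andI (imp_intro h₁) (imp_intro h₂)

theorem mp (h : Γ ⊩ a ⇿ b) (ha : Γ ⊩ a) : Γ ⊩ b := impE (andE₁ h) ha

theorem mpr (h : Γ ⊩ a ⇿ b) (hb : Γ ⊩ b) : Γ ⊩ a := impE (andE₂ h) hb

/-- Universal closure with respect to the variables below `n`. -/
def closure : ℕ → Fm → Fm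
  | 0, a => a
  | n + 1, a => closure n (all a)

theorem closure_elim (n : ℕ) {a : Fm} {ρ : ℕ → ℕ} (h : Γ ⊩ (closure n a).rename fun m => ρ (m + n)) :
    Γ ⊩ a.rename ρ := by
  induction n generalizing a ρ with
  | zero => exact h
  | succ n ih =>
    have : Γ ⊩ (all a).rename fun m => ρ (m + 1) := ih h
    have := allE (ρ 0) this
    rw [inst_rename] at this
    convert this using 2
    funext n; cases n <;> rfl

theorem closure_intro (n : ℕ) {a : Fm} (h : ∀ Γ, Γ ⊩ a) : ∀ Γ, Γ ⊩ closure n a := by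
  induction n generalizing a with
  | zero => exact h
  | succ n ih => exact ih fun Γ => allI (h _)

/-- Closing the formula universally and instantiating permits renamings that identify variables,
which `Proves.rename` does not. Comprehension needs this when two parameters denote the same set. -/
theorem rename_of_forall {a : Fm} (h : ∀ Γ, Γ ⊩ a) (ρ : ℕ → ℕ) : Γ ⊩ a.rename ρ := by
  -- Values beyond the bound are irrelevant; this choice makes the renaming left on the closure the
  -- identity.
  have : Γ ⊩ a.rename fun m => if m < a.bound then ρ m else m - a.bound := by
    refine closure_elim a.bound ?_
    convert closure_intro a.bound h Γ
    rw [← Fm.rename_id (closure _ _), rename_rename]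
    congr 1
    funext m; simp
  rwa [rename_congr fun n hn => if_pos hn] at this

/-- Comprehension for a stratified formula, with arbitrary (possibly equal) parameters `e`. -/
theorem exists_set {a : Fm} (h : a.Stratified) (e : ℕ → ℕ)
    (hc : ∀ s Δ [Step Γ Δ], (∀ k Θ [Le Δ Θ], (Θ ⊩ k ∊ s) ↔ (Θ ⊩ a.rename (cons k e))) → (Δ ⊩ c)) :
    Γ ⊩ c := by
  have := rename_of_forall (Γ := Γ) (fun Γ => postulate (Postulate.compr a h)) e
  refine ex_elim this fun s Δ _ hs => hc s Δ fun k Θ _ => ?_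
  have key := allE k (lift (Δ := Θ) hs)
  have e' : (((a.rename (up Nat.succ)).rename (up (up e))).rename (up (cons s id))).inst k =
      a.rename (cons k e) := by
    rw [inst_rename, rename_rename, rename_rename]
    congr 1
    funext n; cases n <;> rfl
  constructor
  · intro hk
    rw [← e']
    exact mp key hk
  · intro hk
    rw [← e'] at hk
    exact mpr key hk

end Proves

open Proves

variable {Γ : List Fm} {c : Fm}

/-! ### Equality and extensionality -/

theorem set_intro {a b : Fm} (h₁ : ∀ k Δ [Step Γ Δ], (Δ ⊩ a.inst k) → (Δ ⊩ b.inst k))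
    (h₂ : ∀ k Δ [Step Γ Δ], (Δ ⊩ b.inst k) → (Δ ⊩ a.inst k)) : Γ ⊩ all (a ⇿ b) :=
  all_intro fun k => iff_intro (h₁ k) (h₂ k)

theorem eq_symm {x y : ℕ} (h : Γ ⊩ x ≗ y) : Γ ⊩ y ≗ x := eqE (0 ≗ x + 1) h (eqI x)

theorem eq_trans {x y z : ℕ} (h : Γ ⊩ x ≗ y) (h' : Γ ⊩ y ≗ z) : Γ ⊩ x ≗ z :=
  eqE (x + 1 ≗ 0) h' h

theorem mem_left {x y w : ℕ} (h : Γ ⊩ x ≗ y) (hx : Γ ⊩ x ∊ w) : Γ ⊩ y ∊ w :=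
  eqE (0 ∊ w + 1) h hx

theorem mem_right {x y w : ℕ} (h : Γ ⊩ x ≗ y) (hx : Γ ⊩ w ∊ x) : Γ ⊩ w ∊ y :=
  eqE (w + 1 ∊ 0) h hx

theorem ext {x y : ℕ} (h₁ : ∀ k Δ [Step Γ Δ], (Δ ⊩ k ∊ x) → (Δ ⊩ k ∊ y))
    (h₂ : ∀ k Δ [Step Γ Δ], (Δ ⊩ k ∊ y) → (Δ ⊩ k ∊ x)) : Γ ⊩ x ≗ y := by
  have h : Γ ⊩ all (0 ∊ x + 1 ⇿ 0 ∊ y + 1) := set_intro h₁ h₂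
  exact impE (allE y (allE x (postulate Postulate.ext))) h

theorem set_unique {x y : ℕ} {a : Fm} (hx : Γ ⊩ all (0 ∊ x + 1 ⇿ a))
    (hy : Γ ⊩ all (0 ∊ y + 1 ⇿ a)) : Γ ⊩ x ≗ y :=
  ext (fun k _ _ h => mpr (allE k (lift hy)) (mp (allE k (lift hx)) h))
    (fun k _ _ h => mpr (allE k (lift hx)) (mp (allE k (lift hy)) h))

/-- Comprehension, the set being described by a formula. -/
theorem exists_set_all {a : Fm} (h : a.Stratified) (e : ℕ → ℕ)
    (hc : ∀ s Δ [Step Γ Δ],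
      (Δ ⊩ all (0 ∊ s + 1 ⇿ (a.rename (up Nat.succ)).rename (cons 0 (fun n => cons s e n + 1)))) →
      (Δ ⊩ c)) :
    Γ ⊩ c := by
  refine exists_set h e fun s Δ _ hs => hc s Δ (set_intro (fun k Θ _ hk => ?_) fun k Θ _ hk => ?_)
  all_goals
    have e' : ((a.rename (up Nat.succ)).rename (cons 0 (fun n => cons s e n + 1))).inst k =
        a.rename (cons k e) := by
      rw [inst, rename_rename, rename_rename]
      congr 1
      funext n; cases n <;> rfl
  · rw [e']; exact (hs k Θ).1 hk
  · rw [e'] at hk; exact (hs k Θ).2 hk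

/-! ### Elementary sets -/

theorem not_mem_empty {e x : ℕ} (h : Γ ⊩ isEmpty e) (hx : Γ ⊩ x ∊ e) : Γ ⊩ c :=
  neg_elim (allE x h) hx

theorem empty_intro {e : ℕ} (h : ∀ k Δ [Step Γ Δ], (Δ ⊩ k ∊ e) → (Δ ⊩ fls)) : Γ ⊩ isEmpty e :=
  all_intro fun k => imp_intro (h k)

theorem exists_empty (hc : ∀ e Δ [Step Γ Δ], (Δ ⊩ isEmpty e) → (Δ ⊩ c)) : Γ ⊩ c :=
  exists_set (a := fls) ⟨id, trivial⟩ id fun e Δ _ he =>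
    hc e Δ (empty_intro fun k Θ _ hk => (he k Θ).1 hk)

theorem mem_adjoin {w z a k : ℕ} (h : Γ ⊩ isAdjoin w z a) (hk : Γ ⊩ k ∊ z) : Γ ⊩ k ∊ w :=
  mpr (allE k h) (orI₁ hk)

theorem mem_adjoin_self {w z a : ℕ} (h : Γ ⊩ isAdjoin w z a) : Γ ⊩ a ∊ w :=
  mpr (allE a h) (orI₂ (eqI a))

theorem adjoin_cases {w z a k : ℕ} (h : Γ ⊩ isAdjoin w z a) (hk : Γ ⊩ k ∊ w)
    (h₁ : ∀ Δ [Step Γ Δ], (Δ ⊩ k ∊ z) → (Δ ⊩ c)) (h₂ : ∀ Δ [Step Γ Δ], (Δ ⊩ k ≗ a) → (Δ ⊩ c)) :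
    Γ ⊩ c :=
  or_elim (mp (allE k h) hk) h₁ h₂

theorem adjoin_intro {w z a : ℕ}
    (h₁ : ∀ k Δ [Step Γ Δ], (Δ ⊩ k ∊ w) → (Δ ⊩ k ∊ z ⩔ k ≗ a))
    (h₂ : ∀ k Δ [Step Γ Δ], (Δ ⊩ k ∊ z) → (Δ ⊩ k ∊ w)) (h₃ : Γ ⊩ a ∊ w) : Γ ⊩ isAdjoin w z a :=
  set_intro h₁ fun k _ _ h =>
    -- Here and below, `⟨Le.sub⟩` packs several successive extensions into the single one that the
    -- hypothesis expects.
    or_elim (a := k ∊ z) (b := k ≗ a) h (fun Θ _ hk => @h₂ k Θ ⟨Le.sub⟩ hk)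
      fun Θ _ hk => (mem_left (eq_symm hk) h₃ : Θ ⊩ k ∊ w)

theorem exists_adjoin (z a : ℕ) (hc : ∀ w Δ [Step Γ Δ], (Δ ⊩ isAdjoin w z a) → (Δ ⊩ c)) : Γ ⊩ c :=
  exists_set_all (a := 0 ∊ 1 ⩔ 0 ≗ 2) ⟨cons 0 (cons 1 (cons 0 id)), rfl, rfl⟩
    (cons z (cons a id)) hc

theorem mem_union_left {w u v k : ℕ} (h : Γ ⊩ isUnion w u v) (hk : Γ ⊩ k ∊ u) : Γ ⊩ k ∊ w :=
  mpr (allE k h) (orI₁ hk)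

theorem mem_union_right {w u v k : ℕ} (h : Γ ⊩ isUnion w u v) (hk : Γ ⊩ k ∊ v) : Γ ⊩ k ∊ w :=
  mpr (allE k h) (orI₂ hk)

theorem union_cases {w u v k : ℕ} (h : Γ ⊩ isUnion w u v) (hk : Γ ⊩ k ∊ w)
    (h₁ : ∀ Δ [Step Γ Δ], (Δ ⊩ k ∊ u) → (Δ ⊩ c)) (h₂ : ∀ Δ [Step Γ Δ], (Δ ⊩ k ∊ v) → (Δ ⊩ c)) :
    Γ ⊩ c :=
  or_elim (mp (allE k h) hk) h₁ h₂

theorem union_intro {w u v : ℕ}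
    (h₁ : ∀ k Δ [Step Γ Δ], (Δ ⊩ k ∊ w) → (Δ ⊩ k ∊ u ⩔ k ∊ v))
    (h₂ : ∀ k Δ [Step Γ Δ], (Δ ⊩ k ∊ u) → (Δ ⊩ k ∊ w))
    (h₃ : ∀ k Δ [Step Γ Δ], (Δ ⊩ k ∊ v) → (Δ ⊩ k ∊ w)) : Γ ⊩ isUnion w u v :=
  set_intro h₁ fun k _ _ h =>
    or_elim (a := k ∊ u) (b := k ∊ v) h (fun Θ _ hk => @h₂ k Θ ⟨Le.sub⟩ hk)
      fun Θ _ hk => @h₃ k Θ ⟨Le.sub⟩ hk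

theorem exists_union (u v : ℕ) (hc : ∀ w Δ [Step Γ Δ], (Δ ⊩ isUnion w u v) → (Δ ⊩ c)) : Γ ⊩ c :=
  exists_set_all (a := 0 ∊ 1 ⩔ 0 ∊ 2) ⟨cons 0 (cons 1 (cons 1 id)), rfl, rfl⟩
    (cons u (cons v id)) hc

theorem union_comm {w u v : ℕ} (h : Γ ⊩ isUnion w u v) : Γ ⊩ isUnion w v u :=
  union_intro
    (fun _ _ _ hk => union_cases h hk (fun _ _ hk => orI₂ hk) fun _ _ hk => orI₁ hk)
    (fun _ _ _ hk => mem_union_right h.lift hk) fun _ _ _ hk => mem_union_left h.lift hk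

theorem exists_inter (u v : ℕ)
    (hc : ∀ w Δ [Step Γ Δ], (Δ ⊩ all (0 ∊ w + 1 ⇿ 0 ∊ u + 1 ⩓ 0 ∊ v + 1)) → (Δ ⊩ c)) : Γ ⊩ c :=
  exists_set_all (a := 0 ∊ 1 ⩓ 0 ∊ 2) ⟨cons 0 (cons 1 (cons 1 id)), rfl, rfl⟩
    (cons u (cons v id)) hc

theorem disjoint_elim {u v k : ℕ} (h : Γ ⊩ disjoint u v) (hu : Γ ⊩ k ∊ u) (hv : Γ ⊩ k ∊ v) :
    Γ ⊩ c :=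
  neg_elim (allE k h) (andI hu hv)

theorem disjoint_intro {u v : ℕ} (h : ∀ k Δ [Step Γ Δ], (Δ ⊩ k ∊ u) → (Δ ⊩ k ∊ v) → (Δ ⊩ fls)) :
    Γ ⊩ disjoint u v :=
  all_intro fun k => imp_intro fun Δ _ hk => h k Δ (andE₁ hk) (andE₂ hk)

theorem disjoint_comm {u v : ℕ} (h : Γ ⊩ disjoint u v) : Γ ⊩ disjoint v u :=
  disjoint_intro fun _ _ _ h₁ h₂ => disjoint_elim h h₂ h₁

/-! ### Zero, successor and sum -/

theorem mem_zero {o e : ℕ} (h : Γ ⊩ isZero o) (he : Γ ⊩ isEmpty e) : Γ ⊩ e ∊ o :=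
  mpr (allE e h) he

theorem empty_of_mem_zero {o e : ℕ} (h : Γ ⊩ isZero o) (he : Γ ⊩ e ∊ o) : Γ ⊩ isEmpty e :=
  mp (allE e h) he

theorem exists_zero (hc : ∀ o Δ [Step Γ Δ], (Δ ⊩ isZero o) → (Δ ⊩ c)) : Γ ⊩ c :=
  exists_set_all (a := isEmpty 0) ⟨cons 1 id, 0, rfl, trivial⟩ id hc

theorem mem_succ {s k x z a : ℕ} (h : Γ ⊩ isSucc s k) (hz : Γ ⊩ z ∊ k) (ha : Γ ⊩ neg (a ∊ z))
    (hx : Γ ⊩ isAdjoin x z a) : Γ ⊩ x ∊ s :=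
  mpr (allE x h) (exI z (exI a (andI hz (andI ha hx))))

theorem succ_cases {s k x : ℕ} (h : Γ ⊩ isSucc s k) (hx : Γ ⊩ x ∊ s)
    (hc : ∀ z a Δ [Step Γ Δ], (Δ ⊩ z ∊ k) → (Δ ⊩ neg (a ∊ z)) → (Δ ⊩ isAdjoin x z a) → (Δ ⊩ c)) :
    Γ ⊩ c :=
  ex_elim (mp (allE x h) hx) fun z _ _ h => ex_elim h fun a Δ _ h =>
    @hc z a Δ ⟨Le.sub⟩ (andE₁ h) (andE₁ (andE₂ h)) (andE₂ (andE₂ h))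

theorem succ_unique {s t k : ℕ} (h : Γ ⊩ isSucc s k) (h' : Γ ⊩ isSucc t k) : Γ ⊩ s ≗ t :=
  set_unique h h'

theorem isSucc_right {s k l : ℕ} (e : Γ ⊩ k ≗ l) (h : Γ ⊩ isSucc s k) : Γ ⊩ isSucc s l :=
  eqE (isSucc (s + 1) 0) e h

theorem isSucc_left {s t k : ℕ} (e : Γ ⊩ s ≗ t) (h : Γ ⊩ isSucc s k) : Γ ⊩ isSucc t k :=
  eqE (isSucc 0 (k + 1)) e h

theorem Fm.typed_isAdjoin {τ : ℕ → ℕ} {w z a : ℕ} (h₁ : τ w = τ a + 1) (h₂ : τ z = τ a + 1) :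
    (isAdjoin w z a).Typed τ :=
  ⟨τ a, ⟨h₁, h₂, rfl⟩, ⟨h₂, rfl⟩, h₁⟩

/-- Elements, sets and cardinals have indices n, n + 1, n + 2. A cardinal and its successor share an
index, so induction formulas can speak of both. -/
theorem Fm.typed_isSucc {τ : ℕ → ℕ} {s k n : ℕ} (hs : τ s = n + 2) (hk : τ k = n + 2) :
    (isSucc s k).Typed τ := by
  have h : (ex (ex (1 ∊ k + 3 ⩓ neg (0 ∊ 1) ⩓ isAdjoin 2 1 0))).Typed (cons (n + 1) τ) :=
    ⟨n + 1, n, hk, ⟨rfl, trivial⟩, typed_isAdjoin rfl rfl⟩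
  exact ⟨n + 1, ⟨hs, h⟩, h, hs⟩

theorem exists_succ (k : ℕ) (hc : ∀ s Δ [Step Γ Δ], (Δ ⊩ isSucc s k) → (Δ ⊩ c)) : Γ ⊩ c :=
  exists_set_all (a := ex (ex (1 ∊ 3 ⩓ neg (0 ∊ 1) ⩓ isAdjoin 2 1 0)))
    ⟨cons 1 (cons 2 id), 1, 0, rfl, ⟨rfl, trivial⟩, typed_isAdjoin rfl rfl⟩ (cons k id) hc

theorem not_empty_adjoin {x z a : ℕ} (h : Γ ⊩ isAdjoin x z a) (hx : Γ ⊩ isEmpty x) : Γ ⊩ c :=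
  not_mem_empty hx (mem_adjoin_self h)

/-- Zero is not a successor. -/
theorem zero_ne_succ {o k : ℕ} (ho : Γ ⊩ isZero o) (h : Γ ⊩ isSucc o k) : Γ ⊩ c :=
  exists_empty fun _ _ _ he => succ_cases h.lift (mem_zero ho.lift he) fun _ _ _ _ _ _ hx =>
    not_empty_adjoin hx he

theorem mem_sum {r x y z u v : ℕ} (h : Γ ⊩ isSum r x y) (hu : Γ ⊩ u ∊ x) (hv : Γ ⊩ v ∊ y)
    (hd : Γ ⊩ disjoint u v) (hz : Γ ⊩ isUnion z u v) : Γ ⊩ z ∊ r :=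
  mpr (allE z h) (exI u (exI v (andI hu (andI hv (andI hd hz)))))

theorem sum_cases {r x y z : ℕ} (h : Γ ⊩ isSum r x y) (hz : Γ ⊩ z ∊ r)
    (hc : ∀ u v Δ [Step Γ Δ], (Δ ⊩ u ∊ x) → (Δ ⊩ v ∊ y) → (Δ ⊩ disjoint u v) →
      (Δ ⊩ isUnion z u v) → (Δ ⊩ c)) : Γ ⊩ c :=
  ex_elim (mp (allE z h) hz) fun u _ _ h => ex_elim h fun v Δ _ h =>
    @hc u v Δ ⟨Le.sub⟩ (andE₁ h) (andE₁ (andE₂ h)) (andE₁ (andE₂ (andE₂ h)))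
      (andE₂ (andE₂ (andE₂ h)))

theorem sum_intro {r x y : ℕ}
    (h₁ : ∀ z Δ [Step Γ Δ], (Δ ⊩ z ∊ r) → (Δ ⊩ ex (ex (1 ∊ x + 2 ⩓ 0 ∊ y + 2 ⩓ disjoint 1 0 ⩓
      isUnion (z + 2) 1 0))))
    (h₂ : ∀ z u v Δ [Step Γ Δ], (Δ ⊩ u ∊ x) → (Δ ⊩ v ∊ y) → (Δ ⊩ disjoint u v) →
      (Δ ⊩ isUnion z u v) → (Δ ⊩ z ∊ r)) : Γ ⊩ isSum r x y :=
  set_intro h₁ fun z _ _ h => ex_elim h fun u _ _ h => ex_elim h fun v Δ _ h =>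
    @h₂ z u v Δ ⟨Le.sub⟩ (andE₁ h) (andE₁ (andE₂ h)) (andE₁ (andE₂ (andE₂ h)))
      (andE₂ (andE₂ (andE₂ h)))

theorem sum_mem_intro {x y z u v : ℕ} (hu : Γ ⊩ u ∊ x) (hv : Γ ⊩ v ∊ y)
    (hd : Γ ⊩ disjoint u v) (hz : Γ ⊩ isUnion z u v) :
    Γ ⊩ ex (ex (1 ∊ x + 2 ⩓ 0 ∊ y + 2 ⩓ disjoint 1 0 ⩓ isUnion (z + 2) 1 0)) :=
  exI u (exI v (andI hu (andI hv (andI hd hz))))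

theorem sum_unique {r s x y : ℕ} (h : Γ ⊩ isSum r x y) (h' : Γ ⊩ isSum s x y) : Γ ⊩ r ≗ s :=
  set_unique h h'

theorem isSum_first {r s x y : ℕ} (e : Γ ⊩ r ≗ s) (h : Γ ⊩ isSum r x y) : Γ ⊩ isSum s x y :=
  eqE (isSum 0 (x + 1) (y + 1)) e h

theorem isSum_left {r x x' y : ℕ} (e : Γ ⊩ x ≗ x') (h : Γ ⊩ isSum r x y) : Γ ⊩ isSum r x' y :=
  eqE (isSum (r + 1) 0 (y + 1)) e h

theorem isSum_right {r x y y' : ℕ} (e : Γ ⊩ y ≗ y') (h : Γ ⊩ isSum r x y) : Γ ⊩ isSum r x y' :=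
  eqE (isSum (r + 1) (x + 1) 0) e h

theorem Fm.typed_isUnion {τ : ℕ → ℕ} {w u v n : ℕ} (hw : τ w = n + 1) (hu : τ u = n + 1)
    (hv : τ v = n + 1) : (isUnion w u v).Typed τ :=
  ⟨n, ⟨hw, hu, hv⟩, ⟨hu, hv⟩, hw⟩

theorem Fm.typed_sum_body {τ : ℕ → ℕ} {x y n : ℕ} (hx : τ x = n + 2) (hy : τ y = n + 2) :
    (ex (ex (1 ∊ x + 3 ⩓ 0 ∊ y + 3 ⩓ disjoint 1 0 ⩓ isUnion 2 1 0))).Typed (cons (n + 1) τ) :=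
  ⟨n + 1, n + 1, hx, hy, ⟨n, ⟨rfl, rfl⟩, trivial⟩, typed_isUnion (n := n) rfl rfl rfl⟩

theorem Fm.typed_isSum {τ : ℕ → ℕ} {r x y n : ℕ} (hr : τ r = n + 2) (hx : τ x = n + 2)
    (hy : τ y = n + 2) : (isSum r x y).Typed τ :=
  ⟨n + 1, ⟨hr, typed_sum_body hx hy⟩, typed_sum_body hx hy, hr⟩

theorem exists_sum (x y : ℕ) (hc : ∀ r Δ [Step Γ Δ], (Δ ⊩ isSum r x y) → (Δ ⊩ c)) : Γ ⊩ c :=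
  exists_set_all (a := ex (ex (1 ∊ 3 ⩓ 0 ∊ 4 ⩓ disjoint 1 0 ⩓ isUnion 2 1 0)))
    ⟨cons 1 (cons 2 (cons 2 id)), typed_sum_body (τ := cons 2 (cons 2 id)) (x := 0) (y := 1) rfl rfl⟩
    (cons x (cons y id)) hc

theorem sum_comm {r x y : ℕ} (h : Γ ⊩ isSum r x y) : Γ ⊩ isSum r y x :=
  sum_intro
    (fun _ _ _ hz => sum_cases h hz fun _ _ _ _ hu hv hd hz =>
      sum_mem_intro hv hu (disjoint_comm hd) (union_comm hz))
    fun _ _ _ _ _ hu hv hd hz => mem_sum h hv hu (disjoint_comm hd) (union_comm hz)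

theorem union_empty {w u e : ℕ} (he : Γ ⊩ isEmpty e) (h : Γ ⊩ isUnion w u e) : Γ ⊩ u ≗ w :=
  ext (fun _ _ _ hk => mem_union_left h.lift hk) fun _ _ _ hk =>
    union_cases h.lift hk (fun _ _ hk => hk) fun _ _ hk => not_mem_empty he.lift hk

/-- `x + 0 = x` -/
theorem sum_zero {o : ℕ} (x : ℕ) (ho : Γ ⊩ isZero o) : Γ ⊩ isSum x x o := by
  refine sum_intro (fun z Δ _ hz => exists_empty fun e Θ _ he => ?_) fun z u v Δ _ hu hv _ hz => ?_
  · refine sum_mem_intro (hz : Θ ⊩ z ∊ x) (mem_zero ho.lift he)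
      (disjoint_intro fun k _ _ _ hk => not_mem_empty he.lift hk)
      (union_intro (fun _ _ _ hk => orI₁ hk) (fun _ _ _ hk => hk) fun _ _ _ hk =>
        not_mem_empty he.lift hk)
  · exact mem_left (union_empty (empty_of_mem_zero ho hv) hz) hu

/-- `x + y⁺ = (x + y)⁺` -/
theorem sum_succ {x y r s t : ℕ} (hr : Γ ⊩ isSum r x y) (hs : Γ ⊩ isSucc s y)
    (ht : Γ ⊩ isSucc t r) : Γ ⊩ isSum t x s := by
  refine sum_intro (fun k Δ _ hk => ?_) fun k u w Δ _ hu hw hd hk => ?_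
  · refine succ_cases ht.lift hk fun z a Δ _ hz ha hk => ?_
    refine sum_cases hr.lift hz fun u v Δ _ hu hv hd hz => ?_
    -- The new element of u ∪ v is given to the second summand: w = v ∪ {a}.
    refine exists_adjoin v a fun w Δ _ hw => ?_
    refine sum_mem_intro (hu : Δ ⊩ u ∊ x) (mem_succ hs.lift hv.lift (imp_intro fun Δ _ hav => ?_) hw)
      (disjoint_intro fun m Δ _ hm hm' => ?_)
      (union_intro (fun m Δ _ hm => ?_) (fun m Δ _ hm => ?_) fun m Δ _ hm => ?_)
    · exact neg_elim ha (mem_union_right hz.lift hav)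
    · refine adjoin_cases hw.lift hm' (fun Δ _ hm' => disjoint_elim hd.lift hm.lift hm') fun Δ _ e => ?_
      exact neg_elim ha (mem_union_left hz.lift (mem_left e hm.lift))
    · refine adjoin_cases hk.lift hm (fun Δ _ hm => ?_) fun Δ _ e => ?_
      · exact union_cases hz hm (fun Δ _ hm => orI₁ hm) fun Δ _ hm => orI₂ (mem_adjoin hw.lift hm)
      · exact orI₂ (mem_left (eq_symm e) (mem_adjoin_self hw.lift))
    · exact mem_adjoin hk.lift (mem_union_left hz.lift hm)
    · refine adjoin_cases hw.lift hm (fun Δ _ hm => ?_) fun Δ _ e => ?_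
      · exact mem_adjoin hk.lift (mem_union_right hz.lift hm)
      · exact mem_left (eq_symm e) (mem_adjoin_self hk.lift)
  · refine succ_cases hs.lift hw fun v a Δ _ hv ha hw => ?_
    -- Conversely, w = v ∪ {a} is disjoint from u, so a is new to u ∪ v as well.
    refine exists_union u v fun z Δ _ hz => ?_
    refine mem_succ (a := a) ht (mem_sum hr.lift hu.lift hv.lift (disjoint_intro fun m Δ _ hm hm' => ?_) hz)
      (imp_intro fun Δ _ haz => ?_)
      (adjoin_intro (fun m Δ _ hm => ?_) (fun m Δ _ hm => ?_) ?_)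
    · exact disjoint_elim hd hm (mem_adjoin hw.lift hm')
    · exact union_cases hz haz (fun Δ _ h => disjoint_elim hd.lift h (mem_adjoin_self hw.lift))
        fun Δ _ h => neg_elim ha.lift h
    · refine union_cases hk.lift hm (fun Δ _ hm => orI₁ (mem_union_left hz.lift hm)) fun Δ _ hm => ?_
      exact adjoin_cases hw hm (fun Δ _ hm => orI₁ (mem_union_right hz.lift hm)) fun Δ _ e => orI₂ e
    · exact union_cases hz hm (fun Δ _ hm => mem_union_left hk.lift hm) fun Δ _ hm =>
        mem_union_right hk.lift (mem_adjoin hw.lift hm)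
    · exact mem_union_right hk.lift (mem_adjoin_self hw.lift)

/-- A disjoint union (a ∪ b) ∪ c is regrouped as a ∪ (b ∪ c). This is one inclusion of
associativity. -/
theorem sum_assoc_sub {x y z p q r q' k : ℕ} (hp : Γ ⊩ isSum p x y) (hq : Γ ⊩ isSum q p z)
    (hr : Γ ⊩ isSum r y z) (hq' : Γ ⊩ isSum q' x r) (hk : Γ ⊩ k ∊ q) : Γ ⊩ k ∊ q' := by
  refine sum_cases hq hk fun w c Δ _ hw hc hd hk => ?_
  refine sum_cases hp.lift hw fun a b Δ _ ha hb hd' hw => ?_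
  refine exists_union b c fun m Δ _ hm => ?_
  refine mem_sum hq'.lift ha.lift (mem_sum hr.lift hb.lift hc.lift (disjoint_intro fun j Δ _ h h' => ?_) hm)
    (disjoint_intro fun j Δ _ h h' => ?_)
    (union_intro (fun j Δ _ h => ?_) (fun j Δ _ h => ?_) fun j Δ _ h => ?_)
  · exact disjoint_elim hd (mem_union_right hw.lift h) h'
  · exact union_cases hm h' (fun Δ _ h' => disjoint_elim hd'.lift h.lift h') fun Δ _ h' =>
      disjoint_elim hd.lift (mem_union_left hw.lift h.lift) h'
  · refine union_cases hk.lift h (fun Δ _ h => ?_) fun Δ _ h => orI₂ (mem_union_right hm.lift h)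
    exact union_cases hw h (fun Δ _ h => orI₁ h) fun Δ _ h => orI₂ (mem_union_left hm.lift h)
  · exact mem_union_left hk.lift (mem_union_left hw.lift h)
  · exact union_cases hm h (fun Δ _ h => mem_union_left hk.lift (mem_union_right hw.lift h)) fun Δ _ h =>
      mem_union_right hk.lift h

/-- `(x + y) + z = x + (y + z)` -/
theorem sum_assoc {x y z p q r : ℕ} (hp : Γ ⊩ isSum p x y) (hq : Γ ⊩ isSum q p z)
    (hr : Γ ⊩ isSum r y z) : Γ ⊩ isSum q x r := by
  refine exists_sum x r fun q' Δ _ hq' => isSum_first (eq_symm ?_) hq'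
  -- Reversing all sums by commutativity turns the other inclusion into the first.
  exact ext (fun k Δ _ hk => sum_assoc_sub hp.lift hq.lift hr.lift hq'.lift hk) fun k Δ _ hk =>
    sum_assoc_sub (sum_comm hr.lift) (sum_comm hq'.lift) (sum_comm hp.lift) (sum_comm hq.lift) hk

theorem sum_assoc' {x y z p q r : ℕ} (hr : Γ ⊩ isSum r y z) (hq : Γ ⊩ isSum q x r)
    (hp : Γ ⊩ isSum p x y) : Γ ⊩ isSum q p z :=
  sum_comm (sum_assoc (sum_comm hr) (sum_comm hq) (sum_comm hp))

/-- `(a + b) + (c + d) = (a + c) + (b + d)` -/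
theorem sum_sum_comm {a b c d p q r p' q' : ℕ} (hp : Γ ⊩ isSum p a b) (hq : Γ ⊩ isSum q c d)
    (hr : Γ ⊩ isSum r p q) (hp' : Γ ⊩ isSum p' a c) (hq' : Γ ⊩ isSum q' b d) :
    Γ ⊩ isSum r p' q' :=
  -- Both sides equal a + (b + (c + d)), since b + (c + d) = (c + b) + d = c + (b + d).
  exists_sum b q fun _ _ _ h₁ => exists_sum b c fun _ _ _ h₂ =>
    sum_assoc' (sum_assoc (sum_comm h₂) (sum_assoc' hq.lift h₁.lift h₂) hq'.lift)
      (sum_assoc hp.lift hr.lift h₁.lift) hp'.lift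

/-! ### Ordered pairs and triples -/

theorem mem_singleton {s a : ℕ} (h : Γ ⊩ isSingleton s a) : Γ ⊩ a ∊ s := mpr (allE a h) (eqI a)

theorem eq_of_mem_singleton {s a k : ℕ} (h : Γ ⊩ isSingleton s a) (hk : Γ ⊩ k ∊ s) : Γ ⊩ k ≗ a :=
  mp (allE k h) hk

theorem mem_unordered_left {s a b : ℕ} (h : Γ ⊩ isUnordered s a b) : Γ ⊩ a ∊ s :=
  mpr (allE a h) (orI₁ (eqI a))

theorem mem_unordered_right {s a b : ℕ} (h : Γ ⊩ isUnordered s a b) : Γ ⊩ b ∊ s :=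
  mpr (allE b h) (orI₂ (eqI b))

theorem unordered_cases {s a b k : ℕ} (h : Γ ⊩ isUnordered s a b) (hk : Γ ⊩ k ∊ s) :
    Γ ⊩ k ≗ a ⩔ k ≗ b :=
  mp (allE k h) hk

theorem pair_cases {p a b s : ℕ} (h : Γ ⊩ isPair p a b) (hs : Γ ⊩ s ∊ p) :
    Γ ⊩ isSingleton s a ⩔ isUnordered s a b :=
  mp (allE s h) hs

theorem exists_singleton (a : ℕ) (hc : ∀ s Δ [Step Γ Δ], (Δ ⊩ isSingleton s a) → (Δ ⊩ c)) : Γ ⊩ c :=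
  exists_set_all (a := 0 ≗ 1) ⟨fun _ => 0, rfl⟩ (cons a id) hc

theorem exists_unordered (a b : ℕ) (hc : ∀ s Δ [Step Γ Δ], (Δ ⊩ isUnordered s a b) → (Δ ⊩ c)) :
    Γ ⊩ c :=
  exists_set_all (a := 0 ≗ 1 ⩔ 0 ≗ 2) ⟨fun _ => 0, rfl, rfl⟩ (cons a (cons b id)) hc

theorem Fm.typed_isSingleton {τ : ℕ → ℕ} {s a : ℕ} (h : τ s = τ a + 1) : (isSingleton s a).Typed τ :=
  ⟨τ a, ⟨h, rfl⟩, rfl, h⟩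

theorem Fm.typed_isUnordered {τ : ℕ → ℕ} {s a b n : ℕ} (hs : τ s = n + 1) (ha : τ a = n)
    (hb : τ b = n) : (isUnordered s a b).Typed τ :=
  ⟨n, ⟨hs, ha.symm, hb.symm⟩, ⟨ha.symm, hb.symm⟩, hs⟩

theorem Fm.typed_isPair {τ : ℕ → ℕ} {p a b n : ℕ} (hp : τ p = n + 2) (ha : τ a = n)
    (hb : τ b = n) : (isPair p a b).Typed τ := by
  have h : (isSingleton 0 (a + 1) ⩔ isUnordered 0 (a + 1) (b + 1)).Typed (cons (n + 1) τ) :=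
    ⟨typed_isSingleton (congrArg (· + 1) ha.symm), typed_isUnordered (n := n) rfl ha hb⟩
  exact ⟨n + 1, ⟨hp, h⟩, h, hp⟩

/-- A pair lies two levels above its components, and so does {{z}} above z. The double singleton
thus lets x, y and z share one index. -/
theorem Fm.typed_isTriple {τ : ℕ → ℕ} {t x y z n : ℕ} (ht : τ t = n + 4) (hx : τ x = n)
    (hy : τ y = n) (hz : τ z = n) : (isTriple t x y z).Typed τ :=
  ⟨n + 2, n + 1, n + 2, typed_isPair (n := n) rfl hx hy, typed_isSingleton (congrArg (· + 1) hz.symm),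
    typed_isSingleton rfl, typed_isPair (n := n + 2) ht rfl rfl⟩

theorem Fm.typed_tripleMem {τ : ℕ → ℕ} {x y z w n : ℕ} (hw : τ w = n + 5) (hx : τ x = n)
    (hy : τ y = n) (hz : τ z = n) : (tripleMem x y z w).Typed τ :=
  ⟨n + 4, typed_isTriple rfl hx hy hz, hw⟩

theorem exists_pair (a b : ℕ) (hc : ∀ s Δ [Step Γ Δ], (Δ ⊩ isPair s a b) → (Δ ⊩ c)) : Γ ⊩ c :=
  exists_set_all (a := isSingleton 0 1 ⩔ isUnordered 0 1 2)
    ⟨cons 1 (fun _ => 0), typed_isSingleton rfl, typed_isUnordered (n := 0) rfl rfl rfl⟩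
    (cons a (cons b id)) hc

theorem pair_inj_left {p a b a' b' : ℕ} (h : Γ ⊩ isPair p a b) (h' : Γ ⊩ isPair p a' b') :
    Γ ⊩ a ≗ a' := by
  refine exists_singleton a fun s Δ _ hs => ?_
  have hsp : Δ ⊩ s ∊ p := mpr (allE s h.lift) (orI₁ hs)
  refine or_elim (pair_cases h'.lift hsp) (fun Δ _ h => ?_) fun Δ _ h => ?_
  · exact eq_of_mem_singleton h (mem_singleton hs)
  · exact eq_symm (eq_of_mem_singleton hs (mem_unordered_left h))

theorem pair_right_cases {p a b a' b' : ℕ} (h : Γ ⊩ isPair p a b) (h' : Γ ⊩ isPair p a' b') :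
    Γ ⊩ b ≗ a' ⩔ b ≗ b' := by
  refine exists_unordered a b fun s Δ _ hs => ?_
  have hsp : Δ ⊩ s ∊ p := mpr (allE s h.lift) (orI₂ hs)
  refine or_elim (pair_cases h'.lift hsp) (fun Δ _ h => ?_) fun Δ _ h => ?_
  · exact orI₁ (eq_of_mem_singleton h (mem_unordered_right hs.lift))
  · exact unordered_cases h (mem_unordered_right hs.lift)

/-- There is no need to decide whether a = b: b is a' or b', and b' is a or b. In the only case not
immediate, b = a' = a = b'. -/
theorem pair_inj_right {p a b a' b' : ℕ} (h : Γ ⊩ isPair p a b) (h' : Γ ⊩ isPair p a' b') :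
    Γ ⊩ b ≗ b' := by
  refine or_elim (pair_right_cases h h') (fun Δ _ e => ?_) fun Δ _ e => e
  refine or_elim (pair_right_cases h'.lift h.lift) (fun Δ _ e' => ?_) fun Δ _ e' => eq_symm e'
  exact eq_trans e (eq_trans (eq_symm (pair_inj_left h.lift h'.lift)) (eq_symm e'))

theorem triple_intro {t x y z q r s : ℕ} (hq : Γ ⊩ isPair q x y) (hr : Γ ⊩ isSingleton r z)
    (hs : Γ ⊩ isSingleton s r) (ht : Γ ⊩ isPair t q s) : Γ ⊩ isTriple t x y z :=
  exI q (exI r (exI s (andI hq (andI hr (andI hs ht)))))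

theorem triple_elim {t x y z : ℕ} (h : Γ ⊩ isTriple t x y z)
    (hc : ∀ q r s Δ [Step Γ Δ], (Δ ⊩ isPair q x y) → (Δ ⊩ isSingleton r z) →
      (Δ ⊩ isSingleton s r) → (Δ ⊩ isPair t q s) → (Δ ⊩ c)) : Γ ⊩ c :=
  ex_elim h fun q _ _ h => ex_elim h fun r _ _ h => ex_elim h fun s Δ _ h =>
    @hc q r s Δ ⟨Le.sub⟩ (andE₁ h) (andE₁ (andE₂ h)) (andE₁ (andE₂ (andE₂ h)))
      (andE₂ (andE₂ (andE₂ h)))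

theorem exists_triple (x y z : ℕ) (hc : ∀ t Δ [Step Γ Δ], (Δ ⊩ isTriple t x y z) → (Δ ⊩ c)) :
    Γ ⊩ c :=
  exists_pair x y fun q _ _ hq => exists_singleton z fun r _ _ hr => exists_singleton r fun s _ _ hs =>
    exists_pair q s fun t Δ _ ht =>
      @hc t Δ ⟨Le.sub⟩ (triple_intro hq.lift hr.lift hs.lift ht)

theorem triple_unique {t t' x y z : ℕ} (h : Γ ⊩ isTriple t x y z) (h' : Γ ⊩ isTriple t' x y z) :
    Γ ⊩ t ≗ t' := by
  refine triple_elim h fun q r s Δ _ hq hr hs ht => ?_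
  refine triple_elim h'.lift fun q' r' s' Δ _ hq' hr' hs' ht' => ?_
  have e₁ : Δ ⊩ q ≗ q' := set_unique hq.lift hq'
  have e₂ : Δ ⊩ r ≗ r' := set_unique hr.lift hr'
  have hs₂ : Δ ⊩ isSingleton s r' := eqE (isSingleton (s + 1) 0) e₂ hs.lift
  have e₃ : Δ ⊩ s ≗ s' := set_unique hs₂ hs'
  have ht₁ : Δ ⊩ isPair t q' s := eqE (isPair (t + 1) 0 (s + 1)) e₁ ht.lift
  have ht₂ : Δ ⊩ isPair t q' s' := eqE (isPair (t + 1) (q' + 1) 0) e₃ ht₁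
  exact set_unique ht₂ ht'

theorem triple_inj {t x y z x' y' z' : ℕ} (h : Γ ⊩ isTriple t x y z)
    (h' : Γ ⊩ isTriple t x' y' z') : Γ ⊩ x ≗ x' ⩓ y ≗ y' ⩓ z ≗ z' := by
  refine triple_elim h fun q r s Δ _ hq hr hs ht => ?_
  refine triple_elim h'.lift fun q' r' s' Δ _ hq' hr' hs' ht' => ?_
  have e₁ : Δ ⊩ q ≗ q' := pair_inj_left ht.lift ht'
  have e₂ : Δ ⊩ s ≗ s' := pair_inj_right ht.lift ht'
  have hq₂ : Δ ⊩ isPair q' x y := eqE (isPair 0 (x + 1) (y + 1)) e₁ hq.lift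
  have e₃ : Δ ⊩ r ≗ r' := eq_of_mem_singleton hs' (mem_right e₂ (mem_singleton hs.lift))
  exact andI (pair_inj_left hq₂ hq') (andI (pair_inj_right hq₂ hq')
    (eq_of_mem_singleton hr' (mem_right e₃ (mem_singleton hr.lift))))

theorem tripleMem_intro {t x y z w : ℕ} (ht : Γ ⊩ isTriple t x y z) (h : Γ ⊩ t ∊ w) :
    Γ ⊩ tripleMem x y z w :=
  exI t (andI ht h)

theorem tripleMem_elim {x y z w : ℕ} (h : Γ ⊩ tripleMem x y z w)
    (hc : ∀ t Δ [Step Γ Δ], (Δ ⊩ isTriple t x y z) → (Δ ⊩ t ∊ w) → (Δ ⊩ c)) : Γ ⊩ c :=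
  ex_elim h fun t Δ _ h => hc t Δ (andE₁ h) (andE₂ h)

theorem mem_of_tripleMem {t x y z w : ℕ} (h : Γ ⊩ tripleMem x y z w) (ht : Γ ⊩ isTriple t x y z) :
    Γ ⊩ t ∊ w :=
  tripleMem_elim h fun _ _ _ ht' h => mem_left (triple_unique ht' ht) h

theorem tripleMem_congr {x y z x' y' z' w : ℕ} (hx : Γ ⊩ x ≗ x') (hy : Γ ⊩ y ≗ y') (hz : Γ ⊩ z ≗ z')
    (h : Γ ⊩ tripleMem x y z w) : Γ ⊩ tripleMem x' y' z' w := by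
  have h₁ : Γ ⊩ tripleMem x' y z w := eqE (tripleMem 0 (y + 1) (z + 1) (w + 1)) hx h
  have h₂ : Γ ⊩ tripleMem x' y' z w := eqE (tripleMem (x' + 1) 0 (z + 1) (w + 1)) hy h₁
  exact eqE (tripleMem (x' + 1) (y' + 1) 0 (w + 1)) hz h₂

/-! ### Finite and semifinite cardinals -/

theorem exists_fin (o : ℕ) (hc : ∀ F Δ [Step Γ Δ], (Δ ⊩ isFinCard F o) → (Δ ⊩ c)) : Γ ⊩ c :=
  exists_set_all
    (a := all (2 ∊ 0 ⩓ all (all (1 ∊ 2 ⩓ isSucc 0 1 ⩓ inhabited 0 ⇾ 0 ∊ 2)) ⇾ 1 ∊ 0))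
    ⟨fun _ => 2, 3, ⟨rfl, 2, 2, ⟨rfl, typed_isSucc (n := 0) rfl rfl, 1, rfl⟩, rfl⟩, rfl⟩
    (cons o id) hc

theorem exists_semifin (o : ℕ) (hc : ∀ S Δ [Step Γ Δ], (Δ ⊩ isSemifin S o) → (Δ ⊩ c)) : Γ ⊩ c :=
  exists_set_all
    (a := all (2 ∊ 0 ⩓ all (all (1 ∊ 2 ⩓ isSucc 0 1 ⇾ 0 ∊ 2)) ⇾ 1 ∊ 0))
    ⟨fun _ => 2, 3, ⟨rfl, 2, 2, ⟨rfl, typed_isSucc (n := 0) rfl rfl⟩, rfl⟩, rfl⟩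
    (cons o id) hc

theorem fin_zero {F o : ℕ} (hF : Γ ⊩ isFinCard F o) : Γ ⊩ o ∊ F :=
  mpr (allE o hF) (all_intro fun _ => imp_intro fun _ _ h => andE₁ h)

theorem fin_succ {F o m s u : ℕ} (hF : Γ ⊩ isFinCard F o) (hm : Γ ⊩ m ∊ F) (hs : Γ ⊩ isSucc s m)
    (hu : Γ ⊩ u ∊ s) : Γ ⊩ s ∊ F := by
  refine mpr (allE s hF) (all_intro fun w => imp_intro fun Δ _ h => ?_)
  have h : Δ ⊩ o ∊ w ⩓ all (all (1 ∊ w + 2 ⩓ isSucc 0 1 ⩓ inhabited 0 ⇾ 0 ∊ w + 2)) := h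
  have hw : Δ ⊩ m ∊ w := impE (allE w (mp (allE m hF.lift) hm.lift)) h
  have hc : Δ ⊩ m ∊ w ⩓ isSucc s m ⩓ inhabited s ⇾ s ∊ w := allE s (allE m (andE₂ h))
  exact impE hc (andI hw (andI hs.lift (exI u hu.lift)))

theorem semifin_zero {S o : ℕ} (hS : Γ ⊩ isSemifin S o) : Γ ⊩ o ∊ S :=
  mpr (allE o hS) (all_intro fun _ => imp_intro fun _ _ h => andE₁ h)

theorem semifin_succ {S o m s : ℕ} (hS : Γ ⊩ isSemifin S o) (hm : Γ ⊩ m ∊ S)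
    (hs : Γ ⊩ isSucc s m) : Γ ⊩ s ∊ S := by
  refine mpr (allE s hS) (all_intro fun w => imp_intro fun Δ _ h => ?_)
  have h : Δ ⊩ o ∊ w ⩓ all (all (1 ∊ w + 2 ⩓ isSucc 0 1 ⇾ 0 ∊ w + 2)) := h
  have hw : Δ ⊩ m ∊ w := impE (allE w (mp (allE m hS.lift) hm.lift)) h
  have hc : Δ ⊩ m ∊ w ⩓ isSucc s m ⇾ s ∊ w := allE s (allE m (andE₂ h))
  exact impE hc (andI hw hs.lift)

/-- Induction over the finite cardinals. -/
theorem fin_induction {F o k : ℕ} {a : Fm} (ha : a.Stratified) (e : ℕ → ℕ)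
    (hF : Γ ⊩ isFinCard F o) (hk : Γ ⊩ k ∊ F) (zero : Γ ⊩ a.rename (cons o e))
    (succ : ∀ m s u Δ [Step Γ Δ], (Δ ⊩ m ∊ F) → (Δ ⊩ isSucc s m) → (Δ ⊩ u ∊ s) →
      (Δ ⊩ a.rename (cons m e)) → (Δ ⊩ a.rename (cons s e))) : Γ ⊩ a.rename (cons k e) := by
  -- Intersecting the set given by the formula with 𝔽 makes m ∈ 𝔽 available in the successor step.
  refine exists_set ha e fun w Δ _ hw => exists_inter w F fun v Δ _ hv => ?_
  have key : Δ ⊩ o ∊ v ⩓ all (all (1 ∊ v + 2 ⩓ isSucc 0 1 ⩓ inhabited 0 ⇾ 0 ∊ v + 2)) := by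
    refine andI (mpr (allE o hv) (andI ((hw o Δ).2 zero.lift) (fin_zero hF.lift))) ?_
    refine all_intro fun m => all_intro fun s => imp_intro fun Δ _ h => ?_
    refine ex_elim (andE₂ (andE₂ h)) fun u Δ _ hu => ?_
    have hm : Δ ⊩ m ∊ w ⩓ m ∊ F := mp (allE m hv.lift) (andE₁ h).lift
    have hs : Δ ⊩ isSucc s m := (andE₁ (andE₂ h)).lift
    refine mpr (allE s hv.lift) (andI ((hw s Δ).2 ?_) (fin_succ hF.lift (andE₂ hm) hs hu))
    exact @succ m s u Δ ⟨Le.sub⟩ (andE₂ hm) hs hu ((hw m Δ).1 (andE₁ hm))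
  have hkv : Δ ⊩ k ∊ v := impE (allE v (mp (allE k hF.lift) hk.lift)) key
  exact (hw k Δ).1 (andE₁ (mp (allE k hv) hkv))

/-- Induction over the semifinite cardinals. -/
theorem semifin_induction {S o k : ℕ} {a : Fm} (ha : a.Stratified) (e : ℕ → ℕ)
    (hS : Γ ⊩ isSemifin S o) (hk : Γ ⊩ k ∊ S) (zero : Γ ⊩ a.rename (cons o e))
    (succ : ∀ m s Δ [Step Γ Δ], (Δ ⊩ m ∊ S) → (Δ ⊩ isSucc s m) →
      (Δ ⊩ a.rename (cons m e)) → (Δ ⊩ a.rename (cons s e))) : Γ ⊩ a.rename (cons k e) := by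
  refine exists_set ha e fun w Δ _ hw => exists_inter w S fun v Δ _ hv => ?_
  have key : Δ ⊩ o ∊ v ⩓ all (all (1 ∊ v + 2 ⩓ isSucc 0 1 ⇾ 0 ∊ v + 2)) := by
    refine andI (mpr (allE o hv) (andI ((hw o Δ).2 zero.lift) (semifin_zero hS.lift))) ?_
    refine all_intro fun m => all_intro fun s => imp_intro fun Δ _ h => ?_
    have hm : Δ ⊩ m ∊ w ⩓ m ∊ S := mp (allE m hv.lift) (andE₁ h)
    have hs : Δ ⊩ isSucc s m := andE₂ h
    refine mpr (allE s hv.lift) (andI ((hw s Δ).2 ?_) (semifin_succ hS.lift (andE₂ hm) hs))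
    exact @succ m s Δ ⟨Le.sub⟩ (andE₂ hm) hs ((hw m Δ).1 (andE₁ hm))
  have hkv : Δ ⊩ k ∊ v := impE (allE v (mp (allE k hS.lift) hk.lift)) key
  exact (hw k Δ).1 (andE₁ (mp (allE k hv) hkv))

theorem semifin_of_fin {F S o k : ℕ} (hF : Γ ⊩ isFinCard F o) (hS : Γ ⊩ isSemifin S o)
    (hk : Γ ⊩ k ∊ F) : Γ ⊩ k ∊ S :=
  fin_induction (a := 0 ∊ 1) ⟨id, rfl⟩ (cons S id) hF hk (semifin_zero hS)
    fun _ _ _ _ _ _ hs _ h => semifin_succ hS.lift h hs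

/-- An inhabited semifinite cardinal is finite. -/
theorem fin_of_semifin {F S o k u : ℕ} (hF : Γ ⊩ isFinCard F o) (hS : Γ ⊩ isSemifin S o)
    (hk : Γ ⊩ k ∊ S) (hu : Γ ⊩ u ∊ k) : Γ ⊩ k ∊ F := by
  have : Γ ⊩ inhabited k ⇾ k ∊ F :=
    semifin_induction (a := inhabited 0 ⇾ 0 ∊ 1) ⟨cons 1 (cons 2 id), ⟨0, rfl⟩, rfl⟩ (cons F id) hS hk
      (imp_intro fun _ _ _ => fin_zero hF.lift) fun m s Δ _ hm hs h =>
        imp_intro fun Δ _ h' => ex_elim h' fun u Δ _ hu =>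
          -- A member of m⁺ contains a member of m, so the induction hypothesis gives m ∈ 𝔽.
          succ_cases hs.lift hu fun z a Δ _ hz _ _ =>
            fin_succ hF.lift (impE h.lift (exI z hz)) hs.lift hu.lift
  exact impE this (exI u hu)

theorem semifin_cases {S o k : ℕ} (hS : Γ ⊩ isSemifin S o) (hk : Γ ⊩ k ∊ S)
    (h₁ : ∀ Δ [Step Γ Δ], (Δ ⊩ k ≗ o) → (Δ ⊩ c))
    (h₂ : ∀ m Δ [Step Γ Δ], (Δ ⊩ m ∊ S) → (Δ ⊩ isSucc k m) → (Δ ⊩ c)) : Γ ⊩ c := by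
  have : Γ ⊩ k ≗ o ⩔ ex (0 ∊ S + 1 ⩓ isSucc (k + 1) 0) :=
    semifin_induction (a := 0 ≗ 1 ⩔ ex (0 ∊ 3 ⩓ isSucc 1 0))
      ⟨cons 2 (cons 2 (cons 3 id)), rfl, 2, rfl, typed_isSucc (n := 0) rfl rfl⟩
      (cons o (cons S id)) hS hk (orI₁ (eqI o)) fun m _ _ _ hm hs _ => orI₂ (exI m (andI hm hs))
  exact or_elim this h₁ fun Δ _ h => ex_elim h fun m Δ _ h => @h₂ m Δ ⟨Le.sub⟩ (andE₁ h) (andE₂ h)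

/-- Removing any element from a set of cardinality `k⁺` gives one of cardinality `k`. -/
theorem mem_of_adjoin_mem_succ {S o k s u a v : ℕ} (ho : Γ ⊩ isZero o) (hS : Γ ⊩ isSemifin S o)
    (hk : Γ ⊩ k ∊ S) (hs : Γ ⊩ isSucc s k) (hu : Γ ⊩ u ∊ s) (hv : Γ ⊩ isAdjoin u v a)
    (ha : Γ ⊩ neg (a ∊ v)) : Γ ⊩ v ∊ k := by
  -- If the same element is removed from u in both decompositions, the remainders z and v coincide.
  have eq_case : ∀ {Δ : List Fm} {k z b u a v : ℕ}, (Δ ⊩ z ∊ k) → (Δ ⊩ neg (b ∊ z)) →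
      (Δ ⊩ isAdjoin u z b) → (Δ ⊩ isAdjoin u v a) → (Δ ⊩ neg (a ∊ v)) → (Δ ⊩ a ≗ b) →
      (Δ ⊩ v ∊ k) := by
    intro Δ k z b u a v hz hb hzu hvu ha e
    refine mem_left (ext (fun j Δ _ hj => ?_) fun j Δ _ hj => ?_) hz
    · refine adjoin_cases hvu.lift (mem_adjoin hzu.lift hj) (fun _ _ h => h) fun Δ _ h => ?_
      exact neg_elim hb (mem_left (eq_trans h e.lift) hj.lift)
    · refine adjoin_cases hzu.lift (mem_adjoin hvu.lift hj) (fun _ _ h => h) fun Δ _ h => ?_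
      exact neg_elim ha (mem_left (eq_trans h (eq_symm e.lift)) hj.lift)
  -- The sets are quantified inside the induction formula because the hypothesis is applied to the
  -- smaller set z in place of u.
  have : Γ ⊩ all (all (all (all
      (isSucc 3 (k + 4) ⩓ 2 ∊ 3 ⩓ isAdjoin 2 0 1 ⩓ neg (1 ∊ 0) ⇾ 0 ∊ k + 4)))) := by
    refine semifin_induction
      (a := all (all (all (all (isSucc 3 4 ⩓ 2 ∊ 3 ⩓ isAdjoin 2 0 1 ⩓ neg (1 ∊ 0) ⇾ 0 ∊ 4)))))
      ⟨cons 2 id, 2, 1, 0, 1, ⟨typed_isSucc (n := 0) rfl rfl, rfl, typed_isAdjoin rfl rfl, rfl,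
        trivial⟩, rfl⟩ id hS hk ?_ fun k' k Δ _ hk' hk ih => ?_
    · refine all_intro fun s => all_intro fun u => all_intro fun a => all_intro fun v => ?_
      refine imp_intro fun Δ _ h => ?_
      have hs : Δ ⊩ isSucc s o := andE₁ h
      have hu : Δ ⊩ u ∊ s := andE₁ (andE₂ h)
      have hv : Δ ⊩ isAdjoin u v a := andE₁ (andE₂ (andE₂ h))
      have ha : Δ ⊩ neg (a ∊ v) := andE₂ (andE₂ (andE₂ h))
      refine succ_cases hs hu fun z b Δ _ hz hb hzu => ?_
      refine adjoin_cases hzu (mem_adjoin_self hv.lift) (fun Δ _ h => ?_) fun Δ _ e => ?_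
      · exact not_mem_empty (empty_of_mem_zero ho.lift hz.lift) h
      · exact eq_case hz.lift hb.lift hzu.lift hv.lift ha.lift e
    · refine all_intro fun s => all_intro fun u => all_intro fun a => all_intro fun v => ?_
      refine imp_intro fun Δ _ h => ?_
      have hs : Δ ⊩ isSucc s k := andE₁ h
      have hu : Δ ⊩ u ∊ s := andE₁ (andE₂ h)
      have hv : Δ ⊩ isAdjoin u v a := andE₁ (andE₂ (andE₂ h))
      have ha : Δ ⊩ neg (a ∊ v) := andE₂ (andE₂ (andE₂ h))
      refine succ_cases hs hu fun z b Δ _ hz hb hzu => ?_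
      refine adjoin_cases hzu (mem_adjoin_self hv.lift) (fun Δ _ haz => ?_) fun Δ _ e => ?_
      -- Remove both elements: with w = z ∩ v, one has z = w ∪ {a} and v = w ∪ {b}. Induction puts w
      -- in k', and adjoining b then puts v in k'⁺.
      · refine exists_inter z v fun w Δ _ hw => ?_
        have haw : Δ ⊩ isAdjoin z w a := by
          refine adjoin_intro (fun j Δ _ hj => ?_) (fun j Δ _ hj => ?_) haz.lift
          · exact adjoin_cases hv.lift (mem_adjoin hzu.lift hj)
              (fun Δ _ h => orI₁ (mpr (allE j hw.lift) (andI hj.lift h))) fun Δ _ h => orI₂ h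
          · exact andE₁ (mp (allE j hw.lift) hj)
        have hwk : Δ ⊩ w ∊ k' := by
          refine impE (allE w (allE a (allE z (allE k ih.lift)))) (andI hk.lift (andI hz.lift
            (andI haw (imp_intro fun Δ _ h => ?_))))
          have h : Δ ⊩ a ∊ w := h
          exact neg_elim ha.lift (andE₂ (mp (allE a hw.lift) h))
        refine mem_succ hk.lift hwk (imp_intro fun Δ _ h => ?_)
          (adjoin_intro (fun j Δ _ hj => ?_) (fun j Δ _ hj => ?_) ?_ : Δ ⊩ isAdjoin v w b)
        · exact neg_elim hb.lift (andE₁ (mp (allE b hw.lift) h))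
        · exact adjoin_cases hzu.lift (mem_adjoin hv.lift hj)
            (fun Δ _ h => orI₁ (mpr (allE j hw.lift) (andI h hj.lift))) fun Δ _ h => orI₂ h
        · exact andE₂ (mp (allE j hw.lift) hj)
        · refine adjoin_cases hv.lift (mem_adjoin_self hzu.lift) (fun Δ _ h => h) fun Δ _ e => ?_
          exact neg_elim hb.lift (mem_left (eq_symm e) haz.lift)
      · exact eq_case hz.lift hb.lift hzu.lift hv.lift ha.lift e
  exact impE (allE v (allE a (allE u (allE s this)))) (andI hs (andI hu (andI hv ha)))

/-- Semifinite cardinals with a common member are equal. -/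
theorem eq_of_common_mem {S o k l u : ℕ} (ho : Γ ⊩ isZero o) (hS : Γ ⊩ isSemifin S o)
    (hk : Γ ⊩ k ∊ S) (hl : Γ ⊩ l ∊ S) (hu : Γ ⊩ u ∊ k) (hu' : Γ ⊩ u ∊ l) : Γ ⊩ k ≗ l := by
  have : Γ ⊩ all (all (1 ∊ S + 2 ⩓ 0 ∊ k + 2 ⩓ 0 ∊ 1 ⇾ k + 2 ≗ 1)) := by
    refine semifin_induction (a := all (all (1 ∊ 3 ⩓ 0 ∊ 2 ⩓ 0 ∊ 1 ⇾ 2 ≗ 1)))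
      ⟨cons 2 (cons 3 id), 2, 1, ⟨rfl, rfl, rfl⟩, rfl⟩ (cons S id) hS hk ?_
      fun k k' Δ _ hk hk' ih => ?_
    · refine all_intro fun l => all_intro fun u => imp_intro fun Δ _ h => ?_
      have hl : Δ ⊩ l ∊ S := andE₁ h
      have hu : Δ ⊩ u ∊ o := andE₁ (andE₂ h)
      have hu' : Δ ⊩ u ∊ l := andE₂ (andE₂ h)
      refine semifin_cases hS.lift hl (fun Δ _ e => eq_symm e) fun m Δ _ hm hs => ?_
      refine succ_cases hs hu'.lift fun z a Δ _ _ _ h => ?_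
      exact not_empty_adjoin h (empty_of_mem_zero ho.lift hu.lift)
    · refine all_intro fun l => all_intro fun u => imp_intro fun Δ _ h => ?_
      have hl : Δ ⊩ l ∊ S := andE₁ h
      have hu : Δ ⊩ u ∊ k' := andE₁ (andE₂ h)
      have hu' : Δ ⊩ u ∊ l := andE₂ (andE₂ h)
      refine succ_cases hk'.lift hu fun z a Δ _ hz ha hzu => ?_
      refine semifin_cases hS.lift hl.lift (fun Δ _ e => ?_) fun m Δ _ hm hs => ?_
      · exact not_empty_adjoin hzu.lift (empty_of_mem_zero ho.lift (mem_right e hu'.lift))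
      -- Removing a from the common member leaves z, a common member of the two predecessors.
      · have hzm : Δ ⊩ z ∊ m :=
          mem_of_adjoin_mem_succ ho.lift hS.lift hm hs hu'.lift hzu.lift ha.lift
        have e : Δ ⊩ k ≗ m := impE (allE z (allE m ih.lift)) (andI hm (andI hz.lift hzm))
        exact succ_unique hk'.lift (isSucc_right (eq_symm e) hs)
  exact impE (allE u (allE l this)) (andI hl (andI hu hu'))

/-- The member `u` matters: an inhabited m with m⁺ = Λ would have the same successor Λ as m⁺. -/
theorem succ_inj {S o k l s u : ℕ} (ho : Γ ⊩ isZero o) (hS : Γ ⊩ isSemifin S o)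
    (hk : Γ ⊩ k ∊ S) (hl : Γ ⊩ l ∊ S) (hs : Γ ⊩ isSucc s k) (hs' : Γ ⊩ isSucc s l)
    (hu : Γ ⊩ u ∊ s) : Γ ⊩ k ≗ l :=
  succ_cases hs hu fun _ _ _ _ hz ha hzu =>
    eq_of_common_mem ho.lift hS.lift hk.lift hl.lift hz
      (mem_of_adjoin_mem_succ ho.lift hS.lift hl.lift hs'.lift hu.lift hzu ha)

/-- The semifinite cardinals are closed under addition. -/
theorem semifin_sum {S o x y r : ℕ} (ho : Γ ⊩ isZero o) (hS : Γ ⊩ isSemifin S o)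
    (hx : Γ ⊩ x ∊ S) (hy : Γ ⊩ y ∊ S) (hr : Γ ⊩ isSum r x y) : Γ ⊩ r ∊ S := by
  have : Γ ⊩ all (isSum 0 (x + 1) (y + 1) ⇾ 0 ∊ S + 1) := by
    refine semifin_induction (a := all (isSum 0 2 1 ⇾ 0 ∊ 3))
      ⟨cons 2 (cons 2 (cons 3 id)), 2, typed_isSum (n := 0) rfl rfl rfl, rfl⟩ (cons x (cons S id))
      hS hy ?_ fun m s Δ _ hm hs ih => ?_
    · exact all_intro fun r => imp_intro fun Δ _ h =>
        mem_left (sum_unique (sum_zero x ho.lift) h) hx.lift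
    · refine all_intro fun r => imp_intro fun Δ _ h => ?_
      refine exists_sum x m fun q Δ _ hq => exists_succ q fun t Δ _ ht => ?_
      have hqS : Δ ⊩ q ∊ S := impE (allE q ih.lift) hq.lift
      have hts : Δ ⊩ isSum t x s := sum_succ hq.lift hs.lift ht
      exact mem_left (sum_unique hts h.lift) (semifin_succ hS.lift hqS ht)
  exact impE (allE r this) hr

/-! ### The graph of multiplication -/

theorem mulClosed_intro {w S o : ℕ}
    (h₁ : ∀ x Δ [Step Γ Δ], (Δ ⊩ x ∊ S) → (Δ ⊩ tripleMem x o o w))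
    (h₂ : ∀ x Δ [Step Γ Δ], (Δ ⊩ x ∊ S) → (Δ ⊩ tripleMem o x o w))
    (h₃ : ∀ x y z s r Δ [Step Γ Δ], (Δ ⊩ tripleMem x y z w) → (Δ ⊩ isSucc s y) →
      (Δ ⊩ isSum r z x) → (Δ ⊩ tripleMem x s r w)) : Γ ⊩ mulClosed w S o := by
  refine andI (all_intro fun x => imp_intro (h₁ x)) (andI (all_intro fun x => imp_intro (h₂ x)) ?_)
  exact all_intro fun x => all_intro fun y => all_intro fun z => all_intro fun s =>
    all_intro fun r => imp_intro fun Δ _ h => h₃ x y z s r Δ (andE₁ h) (andE₁ (andE₂ h))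
      (andE₂ (andE₂ h))

theorem mulClosed_right_zero {w S o x : ℕ} (h : Γ ⊩ mulClosed w S o) (hx : Γ ⊩ x ∊ S) :
    Γ ⊩ tripleMem x o o w :=
  impE (allE x (andE₁ h)) hx

theorem mulClosed_left_zero {w S o x : ℕ} (h : Γ ⊩ mulClosed w S o) (hx : Γ ⊩ x ∊ S) :
    Γ ⊩ tripleMem o x o w :=
  impE (allE x (andE₁ (andE₂ h))) hx

theorem mulClosed_succ {w S o x y z s r : ℕ} (h : Γ ⊩ mulClosed w S o)
    (hz : Γ ⊩ tripleMem x y z w) (hs : Γ ⊩ isSucc s y) (hr : Γ ⊩ isSum r z x) :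
    Γ ⊩ tripleMem x s r w :=
  impE (allE r (allE s (allE z (allE y (allE x (andE₂ (andE₂ h))))))) (andI hz (andI hs hr))

/-- With cardinals at n + 2, triples of them are at n + 6 and a set of such triples at n + 7. -/
theorem Fm.typed_mulClosed {τ : ℕ → ℕ} {w S o n : ℕ} (hw : τ w = n + 7) (hS : τ S = n + 3)
    (ho : τ o = n + 2) : (mulClosed w S o).Typed τ :=
  ⟨⟨n + 2, hS, typed_tripleMem (n := n + 2) hw rfl ho ho⟩,
    ⟨n + 2, hS, typed_tripleMem (n := n + 2) hw ho rfl ho⟩,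
    ⟨n + 2, n + 2, n + 2, n + 2, n + 2, ⟨typed_tripleMem (n := n + 2) hw rfl rfl rfl,
      typed_isSucc (n := n) rfl rfl, typed_isSum (n := n) rfl rfl rfl⟩,
      typed_tripleMem (n := n + 2) hw rfl rfl rfl⟩⟩

theorem exists_mulGraph (S o : ℕ) (hc : ∀ G Δ [Step Γ Δ], (Δ ⊩ isMulGraph G S o) → (Δ ⊩ c)) :
    Γ ⊩ c :=
  exists_set_all (a := all (mulClosed 0 2 3 ⇾ 1 ∊ 0))
    ⟨cons 6 (cons 3 (cons 2 id)), 7, typed_mulClosed (n := 0) rfl rfl rfl, rfl⟩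
    (cons S (cons o id)) hc

theorem mem_of_mem_mulGraph {G S o t w : ℕ} (hG : Γ ⊩ isMulGraph G S o) (ht : Γ ⊩ t ∊ G)
    (hw : Γ ⊩ mulClosed w S o) : Γ ⊩ t ∊ w :=
  impE (allE w (mp (allE t hG) ht)) hw

theorem mem_mulGraph {G S o t : ℕ} (hG : Γ ⊩ isMulGraph G S o)
    (h : ∀ w Δ [Step Γ Δ], (Δ ⊩ mulClosed w S o) → (Δ ⊩ t ∊ w)) : Γ ⊩ t ∊ G :=
  mpr (allE t hG) (all_intro fun w => imp_intro (h w))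

/-- `tripleMem` may have a different witness for each closed set `w`; uniqueness of triples lets one
fixed triple serve them all. -/
theorem tripleMem_mulGraph {G S o x y z : ℕ} (hG : Γ ⊩ isMulGraph G S o)
    (h : ∀ w Δ [Step Γ Δ], (Δ ⊩ mulClosed w S o) → (Δ ⊩ tripleMem x y z w)) :
    Γ ⊩ tripleMem x y z G :=
  exists_triple x y z fun _ _ _ ht => tripleMem_intro ht (mem_mulGraph hG.lift fun w Δ _ hw =>
    mem_of_tripleMem (@h w Δ ⟨Le.sub⟩ hw) ht.lift)

/-- The graph of multiplication satisfies the conditions defining it. -/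
theorem mulClosed_mulGraph {G S o : ℕ} (hG : Γ ⊩ isMulGraph G S o) : Γ ⊩ mulClosed G S o := by
  refine mulClosed_intro (fun x Δ _ hx => ?_) (fun x Δ _ hx => ?_)
    fun x y z s r Δ _ h hs hr => ?_
  · exact tripleMem_mulGraph hG.lift fun w Δ _ hw => mulClosed_right_zero hw hx.lift
  · exact tripleMem_mulGraph hG.lift fun w Δ _ hw => mulClosed_left_zero hw hx.lift
  · refine tripleMem_mulGraph hG.lift fun w Δ _ hw => mulClosed_succ hw ?_ hs.lift hr.lift
    exact tripleMem_elim h.lift fun t Δ _ ht h =>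
      tripleMem_intro ht (mem_of_mem_mulGraph hG.lift h hw.lift)

/-- The triple `⟨x, y, z⟩` belongs to the graph `G` of multiplication because of one of the
conditions defining `G`. -/
def mulCases (x y z G S o : ℕ) : Fm :=
  y ∊ S ⩓ ((y ≗ o ⩔ x ≗ o) ⩓ z ≗ o ⩔
    ex (ex (1 ∊ S + 2 ⩓ tripleMem (x + 2) 1 0 (G + 2) ⩓ isSucc (y + 2) 1 ⩓ isSum (z + 2) 0 (x + 2))))

theorem Fm.typed_mulCases {τ : ℕ → ℕ} {x y z G S o n : ℕ} (hx : τ x = n + 2) (hy : τ y = n + 2)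
    (hz : τ z = n + 2) (hG : τ G = n + 7) (hS : τ S = n + 3) (ho : τ o = n + 2) :
    (mulCases x y z G S o).Typed τ :=
  ⟨hS.trans (congrArg (· + 1) hy.symm),
    ⟨⟨hy.trans ho.symm, hx.trans ho.symm⟩, hz.trans ho.symm⟩, n + 2, n + 2, hS,
    typed_tripleMem (n := n + 2) hG hx rfl rfl, typed_isSucc (n := n) hy rfl,
    typed_isSum (n := n) hz rfl hx⟩

theorem mulCases_congr {x y z x' y' z' G S o : ℕ} (hx : Γ ⊩ x ≗ x') (hy : Γ ⊩ y ≗ y')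
    (hz : Γ ⊩ z ≗ z') (h : Γ ⊩ mulCases x y z G S o) : Γ ⊩ mulCases x' y' z' G S o := by
  have h₁ : Γ ⊩ mulCases x' y z G S o :=
    eqE (mulCases 0 (y + 1) (z + 1) (G + 1) (S + 1) (o + 1)) hx h
  have h₂ : Γ ⊩ mulCases x' y' z G S o :=
    eqE (mulCases (x' + 1) 0 (z + 1) (G + 1) (S + 1) (o + 1)) hy h₁
  exact eqE (mulCases (x' + 1) (y' + 1) 0 (G + 1) (S + 1) (o + 1)) hz h₂

/-- The triples of 𝔾 that satisfy `mulCases` form a set with the closure conditions, hence contain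
all of 𝔾. Keeping membership in 𝔾 supplies the smaller triple in the successor case. -/
theorem mulCases_of_tripleMem {G S o x y z : ℕ} (hS : Γ ⊩ isSemifin S o)
    (hG : Γ ⊩ isMulGraph G S o) (h : Γ ⊩ tripleMem x y z G) : Γ ⊩ mulCases x y z G S o := by
  refine exists_set (a := 0 ∊ 1 ⩓ ex (ex (ex (isTriple 3 2 1 0 ⩓ mulCases 2 1 0 4 5 6))))
    ⟨cons 6 (cons 7 (cons 3 (cons 2 id))), rfl, 2, 2, 2, typed_isTriple (n := 2) rfl rfl rfl rfl,
      typed_mulCases (n := 0) rfl rfl rfl rfl rfl rfl⟩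
    (cons G (cons S (cons o id))) fun w Δ _ hw => ?_
  have intro_mem : ∀ {Θ : List Fm} [Le Δ Θ] {x y z : ℕ}, (Θ ⊩ tripleMem x y z G) →
      (Θ ⊩ mulCases x y z G S o) → (Θ ⊩ tripleMem x y z w) := by
    intro Θ _ x y z h h'
    refine tripleMem_elim h fun t Θ' _ ht h => tripleMem_intro ht ((hw t Θ').2 (andI h ?_))
    exact exI x (exI y (exI z (andI ht h'.lift)))
  have elim_mem : ∀ {Θ : List Fm} [Le Δ Θ] {x y z : ℕ}, (Θ ⊩ tripleMem x y z w) →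
      (Θ ⊩ tripleMem x y z G ⩓ mulCases x y z G S o) := by
    intro Θ _ x y z h
    refine tripleMem_elim h fun t Θ _ ht h => ?_
    have h : Θ ⊩ t ∊ G ⩓ ex (ex (ex (isTriple (t + 3) 2 1 0 ⩓
      mulCases 2 1 0 (G + 3) (S + 3) (o + 3)))) := (hw t Θ).1 h
    refine andI (tripleMem_intro ht (andE₁ h)) ?_
    refine ex_elim (andE₂ h) fun x' Θ _ h => ex_elim h fun y' Θ _ h => ex_elim h fun z' Θ _ h => ?_
    have e : Θ ⊩ x' ≗ x ⩓ y' ≗ y ⩓ z' ≗ z := triple_inj (andE₁ h) ht.lift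
    exact mulCases_congr (andE₁ e) (andE₁ (andE₂ e)) (andE₂ (andE₂ e)) (andE₂ h)
  have closed : Δ ⊩ mulClosed w S o := by
    have hG' : Δ ⊩ mulClosed G S o := mulClosed_mulGraph hG.lift
    refine mulClosed_intro (fun x Θ _ hx => ?_) (fun x Θ _ hx => ?_)
      fun x y z s r Θ _ h hs hr => ?_
    · exact intro_mem (mulClosed_right_zero hG'.lift hx)
        (andI (semifin_zero hS.lift) (orI₁ (andI (orI₁ (eqI o)) (eqI o))))
    · exact intro_mem (mulClosed_left_zero hG'.lift hx)
        (andI hx (orI₁ (andI (orI₂ (eqI o)) (eqI o))))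
    · have hz := elim_mem h
      refine intro_mem (mulClosed_succ hG'.lift (andE₁ hz) hs hr) ?_
      have hy : Θ ⊩ y ∊ S := andE₁ (andE₂ hz)
      exact andI (semifin_succ hS.lift hy hs)
        (orI₂ (exI y (exI z (andI hy (andI (andE₁ hz) (andI hs hr))))))
  refine tripleMem_elim h.lift fun t Δ _ ht h => andE₂ (elim_mem ?_)
  exact tripleMem_intro ht (mem_of_mem_mulGraph hG.lift h closed.lift)

/-- The assumptions that `o`, `F`, `S`, `G` are `zero`, `𝔽`, `SF`, `𝔾`. -/
structure Arith (Γ : List Fm) (o F S G : ℕ) : Prop where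
  zero : Γ ⊩ isZero o
  fin : Γ ⊩ isFinCard F o
  semifin : Γ ⊩ isSemifin S o
  graph : Γ ⊩ isMulGraph G S o

/-! ### Existence and uniqueness of products of finite cardinals. -/

variable {o F S G : ℕ}

theorem Arith.lift {Δ : List Fm} [Le Γ Δ] (h : Arith Γ o F S G) : Arith Δ o F S G :=
  ⟨h.zero.lift, h.fin.lift, h.semifin.lift, h.graph.lift⟩

/-- `z ↦ ⟨x, y, z⟩ ∈ G` holds for `p` only. -/
def mulValue (x y p G : ℕ) : Fm := all (tripleMem (x + 1) (y + 1) 0 (G + 1) ⇿ 0 ≗ p + 1)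

theorem Arith.mul_right_zero {x : ℕ} (A : Arith Γ o F S G) (hx : Γ ⊩ x ∊ F) :
    Γ ⊩ tripleMem x o o G :=
  mulClosed_right_zero (mulClosed_mulGraph A.graph) (semifin_of_fin A.fin A.semifin hx)

theorem Arith.mul_left_zero {x : ℕ} (A : Arith Γ o F S G) (hx : Γ ⊩ x ∊ F) :
    Γ ⊩ tripleMem o x o G :=
  mulClosed_left_zero (mulClosed_mulGraph A.graph) (semifin_of_fin A.fin A.semifin hx)

/-- `x · y⁺ = x · y + x` -/
theorem Arith.mul_succ {x y z s r : ℕ} (A : Arith Γ o F S G) (hz : Γ ⊩ tripleMem x y z G)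
    (hs : Γ ⊩ isSucc s y) (hr : Γ ⊩ isSum r z x) : Γ ⊩ tripleMem x s r G :=
  mulClosed_succ (mulClosed_mulGraph A.graph) hz hs hr

/-- Induction on y, reading off from `mulCases` what the value can be. Membership in SF is carried
along instead of membership in 𝔽, since the product may be empty. -/
theorem Arith.exists_mulValue {x y : ℕ} (A : Arith Γ o F S G) (hx : Γ ⊩ x ∊ F) (hy : Γ ⊩ y ∊ F) :
    Γ ⊩ ex (0 ∊ S + 1 ⩓ mulValue (x + 1) (y + 1) 0 (G + 1)) := by
  refine fin_induction (a := ex (0 ∊ 3 ⩓ mulValue 2 1 0 4))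
    ⟨cons 2 (cons 2 (cons 3 (cons 7 id))), 2, rfl, 2,
      ⟨typed_tripleMem (n := 2) rfl rfl rfl rfl, rfl⟩, rfl,
      typed_tripleMem (n := 2) rfl rfl rfl rfl⟩
    (cons x (cons S (cons G id))) A.fin hy ?_ fun y s u Δ _ hy hs hu ih => ?_
  · refine exI o (andI (semifin_zero A.semifin) (all_intro fun z =>
      iff_intro (fun Δ _ h => ?_) fun Δ _ h => ?_))
    · have h : Δ ⊩ tripleMem x o z G := h
      have h : Δ ⊩ mulCases x o z G S o := mulCases_of_tripleMem A.semifin.lift A.graph.lift h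
      refine or_elim (andE₂ h) (fun Δ _ h => andE₂ h) fun Δ _ h => ?_
      refine ex_elim h fun y Δ _ h => ex_elim h fun z Δ _ h => ?_
      exact zero_ne_succ A.zero.lift (andE₁ (andE₂ (andE₂ h)))
    · have h : Δ ⊩ z ≗ o := h
      exact tripleMem_congr (eqI x) (eqI o) (eq_symm h) (A.lift.mul_right_zero hx.lift)
  · refine ex_elim ih fun p Δ _ hp => ?_
    refine exists_sum p x fun r Δ _ hr => ?_
    have hpS : Δ ⊩ p ∊ S := (andE₁ hp).lift
    have hp : Δ ⊩ mulValue x y p G := (andE₂ hp).lift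
    have hyS : Δ ⊩ y ∊ S := semifin_of_fin A.fin.lift A.semifin.lift hy.lift
    have hxS : Δ ⊩ x ∊ S := semifin_of_fin A.fin.lift A.semifin.lift hx.lift
    have hxyp : Δ ⊩ tripleMem x y p G := mpr (allE p hp) (eqI p)
    refine exI r (andI (semifin_sum A.zero.lift A.semifin.lift hpS hxS hr) (all_intro fun z =>
      iff_intro (fun Δ _ h => ?_) fun Δ _ h => ?_))
    · have h : Δ ⊩ tripleMem x s z G := h
      have h : Δ ⊩ mulCases x s z G S o := mulCases_of_tripleMem A.semifin.lift A.graph.lift h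
      refine or_elim (andE₂ h) (fun Δ _ h => ?_) fun Δ _ h => ?_
      · have hz : Δ ⊩ z ≗ o := andE₂ h
        refine or_elim (andE₁ h) (fun Δ _ e => ?_) fun Δ _ e => ?_
        · exact zero_ne_succ A.zero.lift (isSucc_left e hs.lift)
        -- The second closure condition must agree with the recursion: for x = zero, the value p of
        -- x · y is zero, so r = zero + zero = zero.
        · have hoyo : Δ ⊩ tripleMem o y o G := A.lift.mul_left_zero hy.lift
          have hxyo : Δ ⊩ tripleMem x y o G := tripleMem_congr (eq_symm e) (eqI y) (eqI o) hoyo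
          have ep : Δ ⊩ o ≗ p := mp (allE o hp.lift) hxyo
          have hr' : Δ ⊩ isSum r o o := isSum_left (eq_symm ep) (isSum_right e hr.lift)
          exact eq_trans hz.lift (sum_unique (sum_zero o A.zero.lift) hr')
      · refine ex_elim h fun y' Δ _ h => ex_elim h fun q Δ _ h => ?_
        have hy' : Δ ⊩ y' ∊ S := andE₁ h
        have hq : Δ ⊩ tripleMem x y' q G := andE₁ (andE₂ h)
        have hs' : Δ ⊩ isSucc s y' := andE₁ (andE₂ (andE₂ h))
        have hz : Δ ⊩ isSum z q x := andE₂ (andE₂ (andE₂ h))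
        -- The successor s has the member u, so its semifinite predecessor is unique.
        have e : Δ ⊩ y' ≗ y := succ_inj A.zero.lift A.semifin.lift hy' hyS.lift hs' hs.lift hu.lift
        have eq : Δ ⊩ q ≗ p := mp (allE q hp.lift) (tripleMem_congr (eqI x) e (eqI q) hq)
        exact sum_unique (isSum_left eq hz) hr.lift
    · have h : Δ ⊩ z ≗ r := h
      exact tripleMem_congr (eqI x) (eqI s) (eq_symm h) (A.lift.mul_succ hxyp.lift hs.lift hr.lift)

theorem Arith.exists_mul {x y : ℕ} (A : Arith Γ o F S G) (hx : Γ ⊩ x ∊ F) (hy : Γ ⊩ y ∊ F)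
    (hc : ∀ p Δ [Step Γ Δ], (Δ ⊩ p ∊ S) → (Δ ⊩ tripleMem x y p G) → (Δ ⊩ c)) : Γ ⊩ c :=
  ex_elim (A.exists_mulValue hx hy) fun p Δ _ h => by
    have h₂ : Δ ⊩ mulValue x y p G := andE₂ h
    exact hc p Δ (andE₁ h) (mpr (allE p h₂) (eqI p))

theorem Arith.mul_unique {x y p q : ℕ} (A : Arith Γ o F S G) (hx : Γ ⊩ x ∊ F) (hy : Γ ⊩ y ∊ F)
    (hp : Γ ⊩ tripleMem x y p G) (hq : Γ ⊩ tripleMem x y q G) : Γ ⊩ p ≗ q :=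
  ex_elim (A.exists_mulValue hx hy) fun r Δ _ h => by
    have h₂ : Δ ⊩ mulValue x y r G := andE₂ h
    have e₁ : Δ ⊩ p ≗ r := mp (allE p h₂) hp.lift
    have e₂ : Δ ⊩ q ≗ r := mp (allE q h₂) hq.lift
    exact eq_trans e₁ (eq_symm e₂)

theorem Arith.isProd_of_tripleMem {x y p : ℕ} (A : Arith Γ o F S G) (hx : Γ ⊩ x ∊ F)
    (hy : Γ ⊩ y ∊ F) (hp : Γ ⊩ tripleMem x y p G) : Γ ⊩ isProd p x y G := by
  refine set_intro (fun k Δ _ hk => exI p (andI hp.lift hk)) fun k Δ _ h => ?_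
  refine ex_elim h fun z Δ _ h => ?_
  have hz : Δ ⊩ tripleMem x y z G := andE₁ h
  have e : Δ ⊩ z ≗ p := A.lift.mul_unique hx.lift hy.lift hz hp.lift
  exact mem_right e (andE₂ h)

/-- The graph has some value q at x, y. The set defining the product is then q itself, so p = q. -/
theorem Arith.tripleMem_of_isProd {x y p : ℕ} (A : Arith Γ o F S G) (hx : Γ ⊩ x ∊ F)
    (hy : Γ ⊩ y ∊ F) (hp : Γ ⊩ isProd p x y G) : Γ ⊩ tripleMem x y p G :=
  A.exists_mul hx hy fun q Δ _ _ hq => by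
    have e : Δ ⊩ q ≗ p := set_unique (A.lift.isProd_of_tripleMem hx.lift hy.lift hq) hp.lift
    exact tripleMem_congr (eqI x) (eqI y) e hq

/-! ### The laws of multiplication -/

/-- If `y + z⁺` is finite, so is `y + z`. -/
theorem Arith.fin_of_sum_succ {r s u : ℕ} (A : Arith Γ o F S G) (hr : Γ ⊩ r ∊ S)
    (hs : Γ ⊩ isSucc s r) (hu : Γ ⊩ u ∊ s) : Γ ⊩ r ∊ F :=
  succ_cases hs hu fun _ _ _ _ hz _ _ => fin_of_semifin A.fin.lift A.semifin.lift hr.lift hz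

theorem fin_inhabited {k : ℕ} (hF : Γ ⊩ isFinCard F o) (ho : Γ ⊩ isZero o) (hk : Γ ⊩ k ∊ F) :
    Γ ⊩ inhabited k :=
  fin_induction (a := inhabited 0) ⟨cons 1 id, 0, rfl⟩ id hF hk
    (exists_empty fun e _ _ he => exI e (mem_zero ho.lift he))
    fun _ _ u _ _ _ _ hu _ => exI u hu

/-- A summand of a finite sum of semifinite cardinals is finite. -/
theorem Arith.fin_of_sum_left {x y r : ℕ} (A : Arith Γ o F S G) (hx : Γ ⊩ x ∊ S)
    (hr : Γ ⊩ isSum r x y) (h : Γ ⊩ r ∊ F) : Γ ⊩ x ∊ F :=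
  ex_elim (fin_inhabited A.fin A.zero h) fun w Δ _ hw => by
    have hw : Δ ⊩ w ∊ r := hw
    exact sum_cases hr.lift hw fun u v Δ _ hu _ _ _ =>
      fin_of_semifin A.fin.lift A.semifin.lift hx.lift hu

/-- `x · (y + z) = x · y + x · z` -/
theorem Arith.mul_sum {x y z s p q r : ℕ} (A : Arith Γ o F S G) (hx : Γ ⊩ x ∊ F) (hy : Γ ⊩ y ∊ F)
    (hz : Γ ⊩ z ∊ F) (hs : Γ ⊩ isSum s y z) (hsF : Γ ⊩ s ∊ F) (hq : Γ ⊩ tripleMem x y q G)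
    (hr : Γ ⊩ tripleMem x z r G) (hp : Γ ⊩ isSum p q r) : Γ ⊩ tripleMem x s p G := by
  have : Γ ⊩ all (all (all (all (isSum 3 (y + 4) (z + 4) ⩓ 3 ∊ F + 4 ⩓
      tripleMem (x + 4) (y + 4) 2 (G + 4) ⩓ tripleMem (x + 4) (z + 4) 1 (G + 4) ⩓ isSum 0 2 1 ⇾
      tripleMem (x + 4) 3 0 (G + 4))))) := by
    refine fin_induction (a := all (all (all (all (isSum 3 6 4 ⩓ 3 ∊ 7 ⩓
        tripleMem 5 6 2 8 ⩓ tripleMem 5 4 1 8 ⩓ isSum 0 2 1 ⇾ tripleMem 5 3 0 8)))))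
      ⟨cons 2 (cons 2 (cons 2 (cons 3 (cons 7 id)))), 2, 2, 2, 2,
        ⟨typed_isSum (n := 0) rfl rfl rfl, rfl, typed_tripleMem (n := 2) rfl rfl rfl rfl,
          typed_tripleMem (n := 2) rfl rfl rfl rfl, typed_isSum (n := 0) rfl rfl rfl⟩,
        typed_tripleMem (n := 2) rfl rfl rfl rfl⟩
      (cons x (cons y (cons F (cons G id)))) A.fin hz ?_ fun z z' u Δ _ hz hz' hu ih => ?_
    · refine all_intro fun s => all_intro fun q => all_intro fun r => all_intro fun p =>
        imp_intro fun Δ _ h => ?_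
      have hs : Δ ⊩ isSum s y o := andE₁ h
      have hq : Δ ⊩ tripleMem x y q G := andE₁ (andE₂ (andE₂ h))
      have hr : Δ ⊩ tripleMem x o r G := andE₁ (andE₂ (andE₂ (andE₂ h)))
      have hp : Δ ⊩ isSum p q r := andE₂ (andE₂ (andE₂ (andE₂ h)))
      have er : Δ ⊩ r ≗ o := A.lift.mul_unique hx.lift (fin_zero A.fin.lift) hr
        (A.lift.mul_right_zero hx.lift)
      have ep : Δ ⊩ q ≗ p := sum_unique (sum_zero q A.zero.lift) (isSum_right er hp)
      have es : Δ ⊩ y ≗ s := sum_unique (sum_zero y A.zero.lift) hs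
      exact tripleMem_congr (eqI x) es ep hq
    · refine all_intro fun s' => all_intro fun q => all_intro fun r' => all_intro fun p' =>
        imp_intro fun Δ _ h => ?_
      have hs' : Δ ⊩ isSum s' y z' := andE₁ h
      have hs'F : Δ ⊩ s' ∊ F := andE₁ (andE₂ h)
      have hq : Δ ⊩ tripleMem x y q G := andE₁ (andE₂ (andE₂ h))
      have hr' : Δ ⊩ tripleMem x z' r' G := andE₁ (andE₂ (andE₂ (andE₂ h)))
      have hp' : Δ ⊩ isSum p' q r' := andE₂ (andE₂ (andE₂ (andE₂ h)))
      have hz'F : Δ ⊩ z' ∊ F := fin_succ A.fin.lift hz.lift hz'.lift hu.lift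
      -- To use the induction hypothesis, y + z must be finite: its successor is y + z⁺, which is
      -- finite and therefore inhabited.
      refine exists_sum y z fun s Δ _ hs => exists_succ s fun t Δ _ ht => ?_
      have ht' : Δ ⊩ isSum t y z' := sum_succ hs.lift hz'.lift ht
      have hs₂ : Δ ⊩ isSucc s' s := isSucc_left (sum_unique ht' hs'.lift) ht
      have hsS : Δ ⊩ s ∊ S := semifin_sum A.zero.lift A.semifin.lift
        (semifin_of_fin A.fin.lift A.semifin.lift hy.lift)
        (semifin_of_fin A.fin.lift A.semifin.lift hz.lift) hs.lift
      refine ex_elim (fin_inhabited A.fin.lift A.zero.lift hs'F.lift) fun v Δ _ hv => ?_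
      have hsF : Δ ⊩ s ∊ F := A.lift.fin_of_sum_succ hsS.lift hs₂.lift hv
      refine A.lift.exists_mul hx.lift hz.lift fun r Δ _ _ hr => ?_
      refine exists_sum r x fun r₂ Δ _ hr₂ => exists_sum q r fun p Δ _ hp => ?_
      refine exists_sum p x fun p₂ Δ _ hp₂ => ?_
      have er : Δ ⊩ r₂ ≗ r' := A.lift.mul_unique hx.lift hz'F.lift
        (A.lift.mul_succ hr.lift hz'.lift hr₂.lift) hr'.lift
      have hsp : Δ ⊩ tripleMem x s p G :=
        impE (allE p (allE r (allE q (allE s ih.lift)))) (andI hs.lift (andI hsF.lift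
          (andI hq.lift (andI hr.lift hp.lift))))
      -- (x · y + x · z) + x = x · y + (x · z + x) = x · y + x · z⁺.
      have hp₃ : Δ ⊩ isSum p₂ q r' := isSum_right er (sum_assoc hp.lift hp₂ hr₂.lift)
      exact tripleMem_congr (eqI x) (eqI s') (sum_unique hp₃ hp'.lift)
        (A.lift.mul_succ hsp hs₂.lift hp₂)
  exact impE (allE p (allE r (allE q (allE s this)))) (andI hs (andI hsF (andI hq (andI hr hp))))

/-- `(x + y) · z = x · z + y · z` -/
theorem Arith.sum_mul {x y z s p q r : ℕ} (A : Arith Γ o F S G) (hx : Γ ⊩ x ∊ F) (hy : Γ ⊩ y ∊ F)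
    (hz : Γ ⊩ z ∊ F) (hs : Γ ⊩ isSum s x y) (hsF : Γ ⊩ s ∊ F) (hq : Γ ⊩ tripleMem x z q G)
    (hr : Γ ⊩ tripleMem y z r G) (hp : Γ ⊩ isSum p q r) : Γ ⊩ tripleMem s z p G := by
  have : Γ ⊩ all (all (all (tripleMem (x + 3) (z + 3) 2 (G + 3) ⩓
      tripleMem (y + 3) (z + 3) 1 (G + 3) ⩓ isSum 0 2 1 ⇾
      tripleMem (s + 3) (z + 3) 0 (G + 3)))) := by
    refine fin_induction (a := all (all (all (tripleMem 4 3 2 7 ⩓ tripleMem 5 3 1 7 ⩓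
        isSum 0 2 1 ⇾ tripleMem 6 3 0 7))))
      ⟨cons 2 (cons 2 (cons 2 (cons 2 (cons 7 id)))), 2, 2, 2,
        ⟨typed_tripleMem (n := 2) rfl rfl rfl rfl, typed_tripleMem (n := 2) rfl rfl rfl rfl,
          typed_isSum (n := 0) rfl rfl rfl⟩,
        typed_tripleMem (n := 2) rfl rfl rfl rfl⟩
      (cons x (cons y (cons s (cons G id)))) A.fin hz ?_ fun z z' u Δ _ hz hz' hu ih => ?_
    · refine all_intro fun q => all_intro fun r => all_intro fun p => imp_intro fun Δ _ h => ?_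
      have hq : Δ ⊩ tripleMem x o q G := andE₁ h
      have hr : Δ ⊩ tripleMem y o r G := andE₁ (andE₂ h)
      have hp : Δ ⊩ isSum p q r := andE₂ (andE₂ h)
      have eq : Δ ⊩ q ≗ o := A.lift.mul_unique hx.lift (fin_zero A.fin.lift) hq
        (A.lift.mul_right_zero hx.lift)
      have er : Δ ⊩ r ≗ o := A.lift.mul_unique hy.lift (fin_zero A.fin.lift) hr
        (A.lift.mul_right_zero hy.lift)
      have ep : Δ ⊩ o ≗ p :=
        sum_unique (sum_zero o A.zero.lift) (isSum_right er (isSum_left eq hp))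
      exact tripleMem_congr (eqI s) (eqI o) ep (A.lift.mul_right_zero hsF.lift)
    · refine all_intro fun q' => all_intro fun r' => all_intro fun p' => imp_intro fun Δ _ h => ?_
      have hq' : Δ ⊩ tripleMem x z' q' G := andE₁ h
      have hr' : Δ ⊩ tripleMem y z' r' G := andE₁ (andE₂ h)
      have hp' : Δ ⊩ isSum p' q' r' := andE₂ (andE₂ h)
      have hz'F : Δ ⊩ z' ∊ F := fin_succ A.fin.lift hz.lift hz'.lift hu.lift
      refine A.lift.exists_mul hx.lift hz.lift fun q Δ _ _ hq => ?_
      refine A.lift.exists_mul hy.lift hz.lift fun r Δ _ _ hr => ?_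
      refine exists_sum q x fun q₂ Δ _ hq₂ => exists_sum r y fun r₂ Δ _ hr₂ => ?_
      refine exists_sum q r fun p Δ _ hp => exists_sum p s fun p₂ Δ _ hp₂ => ?_
      have eq : Δ ⊩ q₂ ≗ q' := A.lift.mul_unique hx.lift hz'F.lift
        (A.lift.mul_succ hq.lift hz'.lift hq₂.lift) hq'.lift
      have er : Δ ⊩ r₂ ≗ r' := A.lift.mul_unique hy.lift hz'F.lift
        (A.lift.mul_succ hr.lift hz'.lift hr₂.lift) hr'.lift
      have hsp : Δ ⊩ tripleMem s z p G :=
        impE (allE p (allE r (allE q ih.lift))) (andI hq.lift (andI hr.lift hp.lift))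
      -- (x · z + y · z) + (x + y) = (x · z + x) + (y · z + y).
      have hp₃ : Δ ⊩ isSum p₂ q₂ r₂ := sum_sum_comm hp.lift hs.lift hp₂ hq₂.lift hr₂.lift
      have ep : Δ ⊩ p₂ ≗ p' := sum_unique (isSum_right er (isSum_left eq hp₃)) hp'.lift
      exact tripleMem_congr (eqI s) (eqI z') ep (A.lift.mul_succ hsp hz'.lift hp₂)
  exact impE (allE p (allE r (allE q this))) (andI hq (andI hr hp))

theorem Arith.exists_one (A : Arith Γ o F S G)
    (hc : ∀ i Δ [Step Γ Δ], (Δ ⊩ isSucc i o) → (Δ ⊩ i ∊ F) → (Δ ⊩ c)) : Γ ⊩ c := by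
  -- The member that makes one finite is Λ ∪ {Λ}. The parameters `e`, `e` coincide although their
  -- indices differ in the comprehension formula.
  refine exists_succ o fun i Δ _ hi => exists_empty fun e Δ _ he => exists_adjoin e e fun w Δ _ hw => ?_
  have hwi : Δ ⊩ w ∊ i := mem_succ hi.lift (mem_zero A.zero.lift he.lift)
    (imp_intro fun Δ _ h => not_mem_empty he.lift h) hw
  exact @hc i Δ ⟨Le.sub⟩ hi.lift (fin_succ A.fin.lift (fin_zero A.fin.lift) hi.lift hwi)

/-- `x⁺ = x + 1` -/
theorem Arith.sum_one {x s i : ℕ} (A : Arith Γ o F S G) (hi : Γ ⊩ isSucc i o)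
    (hs : Γ ⊩ isSucc s x) : Γ ⊩ isSum s x i :=
  sum_succ (sum_zero x A.zero) hi hs

/-- `1 · x = x` -/
theorem Arith.one_mul {x i : ℕ} (A : Arith Γ o F S G) (hi : Γ ⊩ isSucc i o) (hiF : Γ ⊩ i ∊ F)
    (hx : Γ ⊩ x ∊ F) : Γ ⊩ tripleMem i x x G :=
  fin_induction (a := tripleMem 1 0 0 2)
    ⟨cons 2 (cons 2 (cons 7 id)), typed_tripleMem (n := 2) rfl rfl rfl rfl⟩
    (cons i (cons G id)) A.fin hx (A.mul_right_zero hiF)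
    fun _ _ _ _ _ _ hs _ ih => A.lift.mul_succ ih hs (A.lift.sum_one hi.lift hs)

/-- Induction on y: x · y⁺ = x · y + x = y · x + 1 · x = (y + 1) · x, the last step by
`Arith.sum_mul`. -/
theorem Arith.mul_comm {x y p : ℕ} (A : Arith Γ o F S G) (hx : Γ ⊩ x ∊ F) (hy : Γ ⊩ y ∊ F)
    (hp : Γ ⊩ tripleMem x y p G) : Γ ⊩ tripleMem y x p G := by
  refine A.exists_one fun i Δ _ hi hiF => ?_
  have : Δ ⊩ all (tripleMem (x + 1) (y + 1) 0 (G + 1) ⇾ tripleMem (y + 1) (x + 1) 0 (G + 1)) := by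
    refine fin_induction (a := all (tripleMem 2 1 0 3 ⇾ tripleMem 1 2 0 3))
      ⟨cons 2 (cons 2 (cons 7 id)), 2, typed_tripleMem (n := 2) rfl rfl rfl rfl,
        typed_tripleMem (n := 2) rfl rfl rfl rfl⟩
      (cons x (cons G id)) A.fin.lift hy.lift ?_ fun y y' u Δ _ hy hy' hu ih => ?_
    · refine all_intro fun p => imp_intro fun Δ _ h => ?_
      have hp : Δ ⊩ tripleMem x o p G := h
      have e : Δ ⊩ o ≗ p := A.lift.mul_unique hx.lift (fin_zero A.fin.lift)
        (A.lift.mul_right_zero hx.lift) hp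
      exact tripleMem_congr (eqI o) (eqI x) e (A.lift.mul_left_zero hx.lift)
    · refine all_intro fun p' => imp_intro fun Δ _ h => ?_
      have hp' : Δ ⊩ tripleMem x y' p' G := h
      have hy'F : Δ ⊩ y' ∊ F := fin_succ A.fin.lift hy.lift hy'.lift hu.lift
      refine A.lift.exists_mul hx.lift hy.lift fun p Δ _ _ hp => exists_sum p x fun r Δ _ hr => ?_
      have e : Δ ⊩ r ≗ p' := A.lift.mul_unique hx.lift hy'F.lift
        (A.lift.mul_succ hp.lift hy'.lift hr) hp'.lift
      have hyx : Δ ⊩ tripleMem y x p G := impE (allE p ih.lift) hp.lift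
      exact A.lift.sum_mul hy.lift hiF.lift hx.lift (A.lift.sum_one hi.lift hy'.lift) hy'F.lift hyx
        (A.lift.one_mul hi.lift hiF.lift hx.lift) (isSum_first e hr)
  exact impE (allE p this) hp.lift

/-- `x · (y · z) = (x · y) · z`, where `x · y = a` and `y · z = b`. -/
theorem Arith.mul_assoc {x y z a b p : ℕ} (A : Arith Γ o F S G) (hx : Γ ⊩ x ∊ F) (hy : Γ ⊩ y ∊ F)
    (hz : Γ ⊩ z ∊ F) (ha : Γ ⊩ tripleMem x y a G) (haF : Γ ⊩ a ∊ F) (hb : Γ ⊩ tripleMem y z b G)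
    (hbF : Γ ⊩ b ∊ F) (hp : Γ ⊩ tripleMem x b p G) : Γ ⊩ tripleMem a z p G := by
  have : Γ ⊩ all (all (tripleMem (y + 2) (z + 2) 1 (G + 2) ⩓ 1 ∊ F + 2 ⩓
      tripleMem (x + 2) 1 0 (G + 2) ⇾ tripleMem (a + 2) (z + 2) 0 (G + 2))) := by
    refine fin_induction (a := all (all (tripleMem 4 2 1 7 ⩓ 1 ∊ 6 ⩓ tripleMem 3 1 0 7 ⇾
        tripleMem 5 2 0 7)))
      ⟨cons 2 (cons 2 (cons 2 (cons 2 (cons 3 (cons 7 id))))), 2, 2,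
        ⟨typed_tripleMem (n := 2) rfl rfl rfl rfl, rfl, typed_tripleMem (n := 2) rfl rfl rfl rfl⟩,
        typed_tripleMem (n := 2) rfl rfl rfl rfl⟩
      (cons x (cons y (cons a (cons F (cons G id))))) A.fin hz ?_ fun z z' u Δ _ hz hz' hu ih => ?_
    · refine all_intro fun b => all_intro fun p => imp_intro fun Δ _ h => ?_
      have hb : Δ ⊩ tripleMem y o b G := andE₁ h
      have hp : Δ ⊩ tripleMem x b p G := andE₂ (andE₂ h)
      have eb : Δ ⊩ b ≗ o := A.lift.mul_unique hy.lift (fin_zero A.fin.lift) hb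
        (A.lift.mul_right_zero hy.lift)
      have ep : Δ ⊩ o ≗ p := A.lift.mul_unique hx.lift (fin_zero A.fin.lift)
        (A.lift.mul_right_zero hx.lift) (tripleMem_congr (eqI x) eb (eqI p) hp)
      exact tripleMem_congr (eqI a) (eqI o) ep (A.lift.mul_right_zero haF.lift)
    · refine all_intro fun b' => all_intro fun p' => imp_intro fun Δ _ h => ?_
      have hb' : Δ ⊩ tripleMem y z' b' G := andE₁ h
      have hb'F : Δ ⊩ b' ∊ F := andE₁ (andE₂ h)
      have hp' : Δ ⊩ tripleMem x b' p' G := andE₂ (andE₂ h)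
      have hz'F : Δ ⊩ z' ∊ F := fin_succ A.fin.lift hz.lift hz'.lift hu.lift
      refine A.lift.exists_mul hy.lift hz.lift fun b Δ _ hbS hb => exists_sum b y fun b₂ Δ _ hb₂ => ?_
      have eb : Δ ⊩ b₂ ≗ b' := A.lift.mul_unique hy.lift hz'F.lift
        (A.lift.mul_succ hb.lift hz'.lift hb₂) hb'.lift
      have hb₃ : Δ ⊩ isSum b' b y := isSum_first eb hb₂
      -- Finiteness of y · z is inherited from y · z⁺ = y · z + y, of which it is a summand.
      have hbF : Δ ⊩ b ∊ F := A.lift.fin_of_sum_left hbS.lift hb₃ hb'F.lift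
      refine A.lift.exists_mul hx.lift hbF fun p Δ _ _ hp => exists_sum p a fun p₂ Δ _ hp₂ => ?_
      have hap : Δ ⊩ tripleMem a z p G :=
        impE (allE p (allE b ih.lift)) (andI hb.lift (andI hbF.lift hp.lift))
      -- x · (y · z + y) = x · (y · z) + x · y, which the induction hypothesis matches with a · z +
      -- a = a · z⁺.
      have hxp : Δ ⊩ tripleMem x b' p₂ G := A.lift.mul_sum hx.lift hbF.lift hy.lift hb₃.lift
        hb'F.lift hp.lift ha.lift hp₂
      have ep : Δ ⊩ p₂ ≗ p' := A.lift.mul_unique hx.lift hb'F.lift hxp hp'.lift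
      exact tripleMem_congr (eqI a) (eqI z') ep (A.lift.mul_succ hap hz'.lift hp₂)
  exact impE (allE p (allE b this)) (andI hb (andI hbF hp))

/-! ### The assertions about multiplication -/

theorem Arith.mulDefined (A : Arith Γ o F S G) : Γ ⊩ mulDefined F S G := by
  refine all_intro fun x => all_intro fun y => imp_intro fun Δ _ h => ?_
  have hx : Δ ⊩ x ∊ F := andE₁ h
  have hy : Δ ⊩ y ∊ F := andE₂ h
  refine ex_elim (A.lift.exists_mulValue hx hy) fun p Δ _ h => ?_
  have hv : Δ ⊩ mulValue x y p G := andE₂ h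
  have hp : Δ ⊩ tripleMem x y p G := mpr (allE p hv) (eqI p)
  exact exI p (andI (A.lift.isProd_of_tripleMem hx.lift hy.lift hp) (andI (andE₁ h) hv))

theorem Arith.mulSucc (A : Arith Γ o F S G) : Γ ⊩ mulSucc F G := by
  refine all_intro fun x => all_intro fun y => all_intro fun s => imp_intro fun Δ _ h => ?_
  have hx : Δ ⊩ x ∊ F := andE₁ h
  have hy : Δ ⊩ y ∊ F := andE₁ (andE₂ h)
  have hs : Δ ⊩ isSucc s y := andE₁ (andE₂ (andE₂ h))
  have hsF : Δ ⊩ s ∊ F := andE₂ (andE₂ (andE₂ h))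
  refine A.lift.exists_mul hx hy fun q Δ _ hqS hq => exists_sum q x fun p Δ _ hp => ?_
  have hsp : Δ ⊩ tripleMem x s p G := A.lift.mul_succ hq.lift hs.lift hp
  have hpS : Δ ⊩ p ∊ S := semifin_sum A.zero.lift A.semifin.lift hqS.lift
    (semifin_of_fin A.fin.lift A.semifin.lift hx.lift) hp
  refine exI p (exI q (andI (A.lift.isProd_of_tripleMem hx.lift hsF.lift hsp)
    (andI (A.lift.isProd_of_tripleMem hx.lift hy.lift hq.lift) (andI hp
      (imp_intro fun Δ _ h => empty_intro fun k Δ _ hk => ?_)))))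
  -- A member would make the semifinite product finite.
  exact neg_elim h.lift (fin_of_semifin A.fin.lift A.semifin.lift hpS.lift hk)

theorem Arith.rightDistrib (A : Arith Γ o F S G) : Γ ⊩ rightDistrib F G := by
  refine all_intro fun x => all_intro fun y => all_intro fun z => all_intro fun s =>
    imp_intro fun Δ _ h => ?_
  have hx : Δ ⊩ x ∊ F := andE₁ h
  have hy : Δ ⊩ y ∊ F := andE₁ (andE₂ h)
  have hz : Δ ⊩ z ∊ F := andE₁ (andE₂ (andE₂ h))
  have hs : Δ ⊩ isSum s y z := andE₁ (andE₂ (andE₂ (andE₂ h)))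
  have hsF : Δ ⊩ s ∊ F := andE₂ (andE₂ (andE₂ (andE₂ h)))
  refine A.lift.exists_mul hx hy fun q Δ _ _ hq => ?_
  refine A.lift.exists_mul hx.lift hz.lift fun r Δ _ _ hr => exists_sum q r fun p Δ _ hp => ?_
  have hsp : Δ ⊩ tripleMem x s p G :=
    A.lift.mul_sum hx.lift hy.lift hz.lift hs.lift hsF.lift hq.lift hr.lift hp
  exact exI p (exI q (exI r (andI (A.lift.isProd_of_tripleMem hx.lift hsF.lift hsp)
    (andI (A.lift.isProd_of_tripleMem hx.lift hy.lift hq.lift)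
      (andI (A.lift.isProd_of_tripleMem hx.lift hz.lift hr.lift) hp)))))

theorem Arith.leftDistrib (A : Arith Γ o F S G) : Γ ⊩ leftDistrib F G := by
  refine all_intro fun x => all_intro fun y => all_intro fun z => all_intro fun s =>
    imp_intro fun Δ _ h => ?_
  have hx : Δ ⊩ x ∊ F := andE₁ h
  have hy : Δ ⊩ y ∊ F := andE₁ (andE₂ h)
  have hz : Δ ⊩ z ∊ F := andE₁ (andE₂ (andE₂ h))
  have hs : Δ ⊩ isSum s x y := andE₁ (andE₂ (andE₂ (andE₂ h)))
  have hsF : Δ ⊩ s ∊ F := andE₂ (andE₂ (andE₂ (andE₂ h)))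
  refine A.lift.exists_mul hx hz fun q Δ _ _ hq => ?_
  refine A.lift.exists_mul hy.lift hz.lift fun r Δ _ _ hr => exists_sum q r fun p Δ _ hp => ?_
  have hsp : Δ ⊩ tripleMem s z p G :=
    A.lift.sum_mul hx.lift hy.lift hz.lift hs.lift hsF.lift hq.lift hr.lift hp
  exact exI p (exI q (exI r (andI (A.lift.isProd_of_tripleMem hsF.lift hz.lift hsp)
    (andI (A.lift.isProd_of_tripleMem hx.lift hz.lift hq.lift)
      (andI (A.lift.isProd_of_tripleMem hy.lift hz.lift hr.lift) hp)))))

theorem Arith.mulComm (A : Arith Γ o F S G) : Γ ⊩ mulComm F G := by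
  refine all_intro fun x => all_intro fun y => imp_intro fun Δ _ h => ?_
  have hx : Δ ⊩ x ∊ F := andE₁ h
  have hy : Δ ⊩ y ∊ F := andE₂ h
  refine A.lift.exists_mul hx hy fun p Δ _ _ hp => ?_
  exact exI p (andI (A.lift.isProd_of_tripleMem hx.lift hy.lift hp)
    (A.lift.isProd_of_tripleMem hy.lift hx.lift (A.lift.mul_comm hx.lift hy.lift hp)))

theorem Arith.mulAssoc (A : Arith Γ o F S G) : Γ ⊩ mulAssoc F G := by
  refine all_intro fun x => all_intro fun y => all_intro fun z => all_intro fun a =>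
    all_intro fun b => imp_intro fun Δ _ h => ?_
  have hx : Δ ⊩ x ∊ F := andE₁ h
  have hy : Δ ⊩ y ∊ F := andE₁ (andE₂ h)
  have hz : Δ ⊩ z ∊ F := andE₁ (andE₂ (andE₂ h))
  have ha : Δ ⊩ isProd a x y G := andE₁ (andE₂ (andE₂ (andE₂ h)))
  have haF : Δ ⊩ a ∊ F := andE₁ (andE₂ (andE₂ (andE₂ (andE₂ h))))
  have hb : Δ ⊩ isProd b y z G := andE₁ (andE₂ (andE₂ (andE₂ (andE₂ (andE₂ h)))))
  have hbF : Δ ⊩ b ∊ F := andE₂ (andE₂ (andE₂ (andE₂ (andE₂ (andE₂ h)))))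
  have ha' : Δ ⊩ tripleMem x y a G := A.lift.tripleMem_of_isProd hx hy ha
  have hb' : Δ ⊩ tripleMem y z b G := A.lift.tripleMem_of_isProd hy hz hb
  refine A.lift.exists_mul hx hbF fun p Δ _ _ hp => ?_
  exact exI p (andI (A.lift.isProd_of_tripleMem hx.lift hbF.lift hp)
    (A.lift.isProd_of_tripleMem haF.lift hz.lift (A.lift.mul_assoc hx.lift hy.lift hz.lift ha'.lift
      haF.lift hb'.lift hbF.lift hp)))

end INF

/-- INF proves, in intuitionistic logic, that `zero`, `𝔽`, `SF` and `𝔾` (the variables `3, 2, 1, 0`)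
exist, that `𝔾` satisfies the conditions defining it, and the laws of multiplication. -/
theorem mainTheorem6 :
    INF.Proves [] (.ex (.ex (.ex (.ex
      (INF.isZero 3 ⩓ INF.isFinCard 2 3 ⩓ INF.isSemifin 1 3 ⩓ INF.isMulGraph 0 1 3 ⩓
        INF.mulClosed 0 1 3 ⩓
        INF.mulDefined 2 1 0 ⩓
        INF.mulSucc 2 0 ⩓
        INF.rightDistrib 2 0 ⩓
        INF.leftDistrib 2 0 ⩓
        INF.mulComm 2 0 ⩓
        INF.mulAssoc 2 0))))) := by
  refine INF.exists_zero fun o Δ _ ho => INF.exists_fin o fun F Δ _ hF => INF.exists_semifin o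
    fun S Δ _ hS => INF.exists_mulGraph S o fun G Δ _ hG => .exI o (.exI F (.exI S (.exI G ?_)))
  have A : INF.Arith Δ o F S G := ⟨ho.lift, hF.lift, hS.lift, hG⟩
  exact .andI A.zero (.andI A.fin (.andI A.semifin (.andI A.graph (.andI (INF.mulClosed_mulGraph A.graph)
    (.andI A.mulDefined (.andI A.mulSucc (.andI A.rightDistrib (.andI A.leftDistrib
      (.andI A.mulComm A.mulAssoc)))))))))
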